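/- Let $\Sigma$ be a locally compact Polish space with its Borel $\sigma$-algebra, carrying a Radon measure $\mu$. A transition density is a measurable function $g:\Sigma\times\Sigma\to[0,\infty)$ with $\int g(x,y)\,\mu(\mathrm dy)=1$ for all $x\in\Sigma$. A sequence $(Y_i)_{i\ge 0}$ of $\Sigma$-valued random variables is a (time-inhomogeneous) Markov chain with transition densities $(h_i)_{i\ge1}$ if, for all $i\ge 0$, the conditional law of $Y_{i+1}$ given $Y_0,\dots,Y_i$ is $h_{i+1}(Y_i,x)\,\mu(\mathrm dx)$. Let $(g_i)_{i\ge1}$ be transition densities, and let $\hat P$ be a probability measure carrying a Markov chain $Z=(Z_i)_{i\ge0}$ with transition densities $(g_i)_{i\ge1}$ and, independent of $Z$, a pair $\chi=((\hat\xi_k)_{k\ge1},\hat\eta_0)$, where $(\hat\xi_k)_{k\ge1}$ are i.i.d. exponential variables with mean one and $\hat\eta_0$ is a Poisson point process on $\Sigma\times[0,\infty)$ with intensity $\mu\otimes\mathrm dv$, independent of $(\hat\xi_k)_{k\ge1}$. **Proposition.** For every integer $T\ge1$, every $\tilde z\in\Sigma$ and every family $(\tilde g_i)_{i\ge1}$ of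 transition densities, one can define under $\hat P$ (on the same probability space) two sequences $\tilde Z=(\tilde Z_i)_{i\ge0}$ and $\tilde\xi=(\tilde\xi_i)_{i\ge1}$ such that, letting, for $i\ge1$ and $z\in\Sigma$, $$G_i(z)=\sum_{1\le k\le i}\hat\xi_k\,g_k(Z_{k-1},z),\qquad \tilde G_i(z)=\sum_{1\le k\le i}\tilde\xi_k\,\tilde g_k(\tilde Z_{k-1},z),$$ the following hold: 1. $\tilde Z$ is a Markov chain with $\tilde Z_0=\tilde z$ and transition densities $(\tilde g_i)_{i\ge1}$; 2. $(\tilde\xi_i)_{i\ge1}$ are i.i.d. exponential variables with mean one, and $\tilde\xi$ is independent of $\tilde Z$; 3. for all $p,m,n\in\{1,\dots,T\}$, $$\{\tilde G_p(z)\le G_m(z)\le\tilde G_n(z)\ \text{for all } z\in\Sigma\}\subset\{\{\tilde Z_1,\dots,\tilde Z_p\}\subset\{Z_1,\dots,Z_m\}\subset\{\tilde Z_1,\dots,\tilde Z_n\}\}.$$ -/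

import Mathlib

open MeasureTheory ProbabilityTheory
open scoped NNReal ENNReal

namespace InverseSLT

/-- `g : S × S → ℝ₊` is a transition density with respect to `μ`: it is (jointly) measurable and
`∫ g(x, y) μ(dy) = 1` for every `x`. -/
structure IsTransitionDensity {S : Type*} [MeasurableSpace S] (μ : Measure S)
    (g : S → S → ℝ≥0) : Prop where
  measurable : Measurable (Function.uncurry g)
  lintegral_eq_one : ∀ x, ∫⁻ y, (g x y : ℝ≥0∞) ∂μ = 1

/-- Under `P`, the sequence `Z = (Z i)_{i ≥ 0}` is a time-inhomogeneous Markov chain with transition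
densities `(g i)_{i ≥ 1}` with respect to `μ`: for every `i ≥ 0` and every measurable `A`,
`P(Z (i+1) ∈ A | Z 0, …, Z i) = ∫_A g (i+1) (Z i, x) μ(dx)` almost surely. The value `g 0` is
not used. -/
structure IsMarkovChain {Ω S : Type*} [MeasurableSpace Ω] [MeasurableSpace S]
    (P : Measure Ω) (μ : Measure S) (g : ℕ → S → S → ℝ≥0) (Z : ℕ → Ω → S) : Prop where
  measurable : ∀ i, Measurable (Z i)
  condProb : ∀ (i : ℕ) (A : Set S), MeasurableSet A →
    P⟦Z (i + 1) ⁻¹' A | ⨆ j ≤ i, MeasurableSpace.comap (Z j) inferInstance⟧ =ᵐ[P]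
      fun ω => ∫ x in A, (g (i + 1) (Z i ω) x : ℝ) ∂μ

/-- Under `P`, the variables `(ξ k)_{k ≥ 1}` are i.i.d. exponential with mean one. The value `ξ 0` is
not used. -/
structure IsIIDExp {Ω : Type*} [MeasurableSpace Ω] (P : Measure Ω) (ξ : ℕ → Ω → ℝ) : Prop where
  measurable : ∀ k ≥ 1, Measurable (ξ k)
  law : ∀ k ≥ 1, P.map (ξ k) = expMeasure 1
  indep : iIndepFun (fun k => ξ (k + 1)) P

/-- A point measure: a finite or countable sum of Dirac masses. -/
def IsPointMeasure {E : Type*} [MeasurableSpace E] (m : Measure E) : Prop :=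
  ∃ (I : Set ℕ) (x : I → E), m = Measure.sum fun i : I => Measure.dirac (x i)

/-- Under `P`, the random measure `η` is a Poisson point process on `E` with intensity `ν`: it is a
random point measure, `η(A)` is Poisson with parameter `ν(A)` whenever `ν(A) < ∞`, and the
variables `η(A i)` are independent for disjoint `A i`. Measurability refers to the σ-algebra on
measures generated by the maps `m ↦ m A`, `A` measurable. -/
structure IsPoissonProcess {Ω E : Type*} [MeasurableSpace Ω] [MeasurableSpace E]
    (P : Measure Ω) (ν : Measure E) (η : Ω → Measure E) : Prop where
  measurable : Measurable η
  isPointMeasure : ∀ᵐ ω ∂P, IsPointMeasure (η ω)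
  law : ∀ A : Set E, MeasurableSet A → ν A ≠ ∞ →
    P.map (fun ω => η ω A) = (poissonMeasure (ν A).toNNReal).map (fun n : ℕ => (n : ℝ≥0∞))
  indep : ∀ (n : ℕ) (A : Fin n → Set E), (∀ i, MeasurableSet (A i)) →
    Pairwise (Function.onFun Disjoint A) → iIndepFun (fun i ω => η ω (A i)) P

/-- The soft local time field `G_i(z) = ∑_{1 ≤ k ≤ i} ξ_k g_k(Z_{k-1}, z)`. -/
noncomputable def softLocalTime {Ω S : Type*} (ξ : ℕ → Ω → ℝ) (g : ℕ → S → S → ℝ≥0)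
    (Z : ℕ → Ω → S) (i : ℕ) (ω : Ω) (z : S) : ℝ :=
  ∑ k ∈ Finset.Icc 1 i, ξ k ω * (g k (Z (k - 1) ω) z : ℝ)

/-- The range `{Z_1, …, Z_n}` for the realization `ω`. -/
def range {Ω S : Type*} (Z : ℕ → Ω → S) (n : ℕ) (ω : Ω) : Set S :=
  (fun i => Z i ω) '' Set.Icc 1 n

/-- The setting, under the extended measure `P`: `Z` is a Markov chain with transition densities
`g` relative to `μ`; `η₀` is a Poisson point process on `S × ℝ₊` with intensity `μ ⊗ dv`
(realized on `S × ℝ`, with the intensity carried by `v ≥ 0`); `(ξ k)_{k ≥ 1}` are i.i.d. exponential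
variables with mean one, independent of `η₀`; and the pair `χ = ((ξ k)_{k ≥ 1}, η₀)` is independent
of `Z`. -/
structure ExtendedSetup {Ω S : Type*} [MeasurableSpace Ω] [MeasurableSpace S]
    (P : Measure Ω) (μ : Measure S) (g : ℕ → S → S → ℝ≥0) (Z : ℕ → Ω → S)
    (ξ : ℕ → Ω → ℝ) (η₀ : Ω → Measure (S × ℝ)) : Prop where
  markov : IsMarkovChain P μ g Z
  exponential : IsIIDExp P ξ
  poisson : IsPoissonProcess P (μ.prod (volume.restrict (Set.Ici (0 : ℝ)))) η₀
  indep_exponential_poisson : IndepFun (fun ω (k : ℕ) => ξ (k + 1) ω) η₀ P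
  indep_chain : IndepFun (fun ω (i : ℕ) => Z i ω)
    (fun ω => ((fun k : ℕ => ξ (k + 1) ω), η₀ ω)) P

end InverseSLT

/-! The argument realises both chains as explorations of one Poisson point process on `S × [0, ∞)`
with intensity `μ ⊗ dv`.

For a probability density `f`, let the graph of `t f` rise from `t = 0` until it meets a first point
of the process. The region under `t f` has intensity `t`, so the meeting time is exponential with
mean one. The location of the point has law `f μ`. The configuration above the graph, translated
down by `t f`, is again a Poisson process with the same law, independent of location and time
(`IsPoissonLaw.map_step`). This is derived from Mecke's formula (`IsPoissonLaw.mecke`), which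
replaces a sum over the points of the process by an integral over one added point. Repeating the
step with `f` the next transition density at the current state produces a Markov chain with
independent exponential marks, and the region explored after `n` steps is the one under the soft
local time.

The step is almost surely invertible: lifting the residual configuration and putting the point back
restores the original one (`IsPoissonLaw.ae_unstep_step`). Hence inserting a point with the right
law below an independent Poisson process gives a Poisson process (`IsPoissonLaw.map_unstep`).
Starting from `η₀` and inserting the points of `Z` and `ξ` backwards, from index `T` down to `1`,
yields a Poisson process `R 0` (`fill_spec`) that `Z` and `ξ` explore by construction. Exploring the
same `R 0` with the densities `g'` from `z'` defines `Z'` and its marks (`isMarkedChain_explore`).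

Almost surely, every atom of `R 0` on or under the graph of a soft local time after `n` steps sits
above one of the first `n` states of its chain, and each of these states carries such an atom. An
inequality between two soft local times therefore gives an inclusion of ranges
(`range_subset_of_softLocalTime_le`).

The inclusion of events has to hold for every `ω`. On a null set the marks `ξ'` are redefined to be
so negative that, after integration in `z`, the assumed inequality is impossible. -/

namespace InverseSLT

/-! ### Uniqueness of laws of random measures -/

/-- The cell of the partition generated by the finite family `t`, selected by the subfamily `s`. -/
def cell {E : Type*} (t s : Finset (Set E)) : Set E :=
  {x | ∀ A ∈ t, x ∈ A ↔ A ∈ s}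

lemma measurableSet_cell {E : Type*} [MeasurableSpace E] {t : Finset (Set E)}
    (ht : ∀ A ∈ t, MeasurableSet A) (s : Finset (Set E)) : MeasurableSet (cell t s) := by
  have : cell t s = ⋂ A ∈ t, {x | x ∈ A ↔ A ∈ s} := by ext; simp [cell]
  rw [this]
  refine t.measurableSet_biInter fun A hA => ?_
  by_cases hs : A ∈ s
  · simpa [hs] using ht A hA
  · simp only [hs, iff_false]
    exact (ht A hA).compl

lemma disjoint_cell {E : Type*} {t s s' : Finset (Set E)} (hs : s ⊆ t) (hs' : s' ⊆ t)
    (hne : s ≠ s') : Disjoint (cell t s) (cell t s') := by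
  rw [Set.disjoint_left]
  intro x hx hx'
  apply hne
  ext A
  constructor
  · intro h; exact (hx' A (hs h)).1 ((hx A (hs h)).2 h)
  · intro h; exact (hx A (hs' h)).1 ((hx' A (hs' h)).2 h)

open Classical in
lemma eq_biUnion_cell {E : Type*} {t : Finset (Set E)} {A : Set E} (hA : A ∈ t) :
    A = ⋃ s ∈ t.powerset.filter (A ∈ ·), cell t s := by
  ext x
  simp only [Finset.mem_filter, Finset.mem_powerset, Set.mem_iUnion]
  constructor
  · intro hx
    refine ⟨t.filter (x ∈ ·), ⟨Finset.filter_subset _ _, by simp [hA, hx]⟩, ?_⟩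
    intro B hB
    simp [hB]
  · rintro ⟨s, ⟨_, hs⟩, hx⟩
    exact (hx A hA).2 hs

section Ext

variable {E : Type*} [MeasurableSpace E]

lemma measurable_eval_family {ι : Type*} {A : ι → Set E} (hA : ∀ i, MeasurableSet (A i)) :
    Measurable fun (m : Measure E) i => m (A i) :=
  measurable_pi_lambda _ fun i => Measure.measurable_coe (hA i)

/-- Two finite measures on `ι → ℝ≥0∞` that agree on boxes are equal. -/
lemma ext_of_box {ι : Type*} [Fintype ι] {ρ₁ ρ₂ : Measure (ι → ℝ≥0∞)} [IsFiniteMeasure ρ₁]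
    (h : ∀ C : ι → Set ℝ≥0∞, (∀ i, MeasurableSet (C i)) →
      ρ₁ {a | ∀ i, a i ∈ C i} = ρ₂ {a | ∀ i, a i ∈ C i}) : ρ₁ = ρ₂ := by
  refine ext_of_generate_finite _ generateFrom_pi.symm isPiSystem_pi ?_ ?_
  · rintro s ⟨C, hC, rfl⟩
    have := h C (fun i => hC i trivial)
    convert this using 2 <;> (ext; simp)
  · simpa using h (fun _ => Set.univ) (fun _ => MeasurableSet.univ)

/-- By continuity from below along an exhaustion by `ν`-finite sets, evaluation at any measurable
set is a supremum of evaluations at `ν`-finite ones. Poisson counts are only prescribed on the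
latter. -/
lemma measurableSpace_le_of_finite (ν : Measure E) [SigmaFinite ν] :
    (inferInstance : MeasurableSpace (Measure E)) ≤
      ⨆ A : {A : Set E // MeasurableSet A ∧ ν A < ∞},
        MeasurableSpace.comap (fun m : Measure E => m A) inferInstance := by
  refine iSup₂_le fun A hA => ?_
  rw [← measurable_iff_comap_le]
  have key : ∀ m : Measure E, m A = ⨆ k, m (A ∩ spanningSets ν k) := by
    intro m
    rw [← Monotone.measure_iUnion, ← Set.inter_iUnion, iUnion_spanningSets, Set.inter_univ]
    exact fun i j hij => Set.inter_subset_inter_right _ (monotone_spanningSets ν hij)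
  have : (fun m : Measure E => m A) = fun m : Measure E => ⨆ k, m (A ∩ spanningSets ν k) :=
    funext key
  rw [this]
  refine Measurable.iSup fun k => ?_
  rw [measurable_iff_comap_le]
  exact le_iSup (fun A : {A : Set E // MeasurableSet A ∧ ν A < ∞} =>
    MeasurableSpace.comap (fun m : Measure E => m A) inferInstance)
    ⟨A ∩ spanningSets ν k, hA.inter (measurableSet_spanningSets ν k),
      (measure_mono Set.inter_subset_right).trans_lt (measure_spanningSets_lt_top ν k)⟩

/-- Finite measures on the space of measures are determined by their values on the events
`{m | ∀ i, m (A i) ∈ C i}` for finite disjoint families of `ν`-finite sets that decompose `B`. -/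
theorem ext_of_disjoint (ν : Measure E) [SigmaFinite ν] {B : Set E} (hB : MeasurableSet B)
    (hBν : ν B < ∞) {ρ₁ ρ₂ : Measure (Measure E)} [IsFiniteMeasure ρ₁]
    (h : ∀ (n : ℕ) (A : Fin n → Set E), (∀ i, MeasurableSet (A i)) → (∀ i, ν (A i) < ∞) →
      Pairwise (Function.onFun Disjoint A) → (∃ J : Finset (Fin n), B = ⋃ j ∈ J, A j) →
      ∀ C : Fin n → Set ℝ≥0∞, (∀ i, MeasurableSet (C i)) →
        ρ₁ {m | ∀ i, m (A i) ∈ C i} = ρ₂ {m | ∀ i, m (A i) ∈ C i}) : ρ₁ = ρ₂ := by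
  classical
  have hfin : ∀ (ι : Type _) [Fintype ι] (A : ι → Set E), (∀ i, MeasurableSet (A i)) →
      (∀ i, ν (A i) < ∞) → Pairwise (Function.onFun Disjoint A) →
      (∃ J : Finset ι, B = ⋃ j ∈ J, A j) →
      ρ₁.map (fun m i => m (A i)) = ρ₂.map (fun m i => m (A i)) := by
    intro ι _ A hA hAν hd ⟨J, hJ⟩
    refine ext_of_box fun C hC => ?_
    have hm : MeasurableSet {a : ι → ℝ≥0∞ | ∀ i, a i ∈ C i} := by
      have : {a : ι → ℝ≥0∞ | ∀ i, a i ∈ C i} = Set.univ.pi C := by ext; simp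
      rw [this]; exact MeasurableSet.univ_pi hC
    rw [Measure.map_apply (measurable_eval_family hA) hm,
      Measure.map_apply (measurable_eval_family hA) hm]
    let e := (Fintype.equivFin ι).symm
    have := h _ (fun i => A (e i)) (fun i => hA _) (fun i => hAν _)
      (fun i j hij => hd (e.injective.ne hij))
      ⟨J.map e.symm.toEmbedding, by rw [hJ]; ext x; simp [e.surjective.exists]⟩
      (fun i => C (e i)) (fun i => hC _)
    convert this using 2 <;>
      (ext m; simp only [Set.mem_preimage, Set.mem_ofPred_eq]; exact e.surjective.forall)
  have huniv : ρ₁ Set.univ = ρ₂ Set.univ := by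
    simpa using h 1 (fun _ => B) (fun _ => hB) (fun _ => hBν)
      (fun i j hij => (hij (Subsingleton.elim i j)).elim) ⟨Finset.univ, by simp⟩
      (fun _ => Set.univ) (fun _ => MeasurableSet.univ)
  let I := {A : Set E // MeasurableSet A ∧ ν A < ∞}
  let π : I → Set (Set (Measure E)) := fun A =>
    {s | MeasurableSet[MeasurableSpace.comap (fun m : Measure E => m A) inferInstance] s}
  have hgen : (inferInstance : MeasurableSpace (Measure E)) =
      MeasurableSpace.generateFrom (piiUnionInter π Set.univ) := by
    have := generateFrom_piiUnionInter_measurableSet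
      (fun A : I => MeasurableSpace.comap (fun m : Measure E => m A) inferInstance) Set.univ
    rw [this]
    refine le_antisymm (by simpa using measurableSpace_le_of_finite ν) ?_
    refine iSup₂_le fun A _ => ?_
    rw [← measurable_iff_comap_le]
    exact Measure.measurable_coe A.2.1
  refine ext_of_generate_finite _ hgen
    (isPiSystem_piiUnionInter π (fun A => @MeasurableSpace.isPiSystem_measurableSet _ (_)) _)
    ?_ huniv
  rintro s ⟨u, -, D, hD, rfl⟩
  have hD' : ∀ A : I, ∃ C : Set ℝ≥0∞, MeasurableSet C ∧
      (A ∈ u → D A = (fun m : Measure E => m A) ⁻¹' C) := by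
    intro A
    by_cases hA : A ∈ u
    · obtain ⟨C, hC, h⟩ := hD A hA
      exact ⟨C, hC, fun _ => h.symm⟩
    · exact ⟨∅, MeasurableSet.empty, fun h => (hA h).elim⟩
  choose C hC hDC using hD'
  -- `B` joins the family so that it becomes a union of cells, as the hypothesis `h` requires.
  let t : Finset (Set E) := insert B (u.map (Function.Embedding.subtype _))
  have ht : ∀ A ∈ t, MeasurableSet A ∧ ν A < ∞ := by
    intro A hA
    rcases Finset.mem_insert.1 hA with rfl | hA
    · exact ⟨hB, hBν⟩
    · obtain ⟨A, -, rfl⟩ := Finset.mem_map.1 hA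
      exact A.2
  have htm : ∀ A ∈ t, MeasurableSet A := fun A hA => (ht A hA).1
  -- The empty subfamily is excluded: its cell is the complement of all members of `t`, possibly of
  -- infinite `ν`-measure, and no member of `t` needs it.
  let κ := {s // s ∈ t.powerset.filter Finset.Nonempty}
  have hsub : ∀ s : κ, s.1 ⊆ t := fun s => by
    have := s.2; simp only [Finset.mem_filter, Finset.mem_powerset] at this; exact this.1
  have hunion : ∀ A ∈ t, A = ⋃ s ∈ (Finset.univ.filter fun s : κ => A ∈ s.1), cell t s.1 := by
    intro A hA
    refine (eq_biUnion_cell hA).trans ?_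
    ext x
    simp only [Finset.mem_filter, Finset.mem_powerset, Set.mem_iUnion, Finset.mem_univ, true_and]
    constructor
    · rintro ⟨s, ⟨h1, h2⟩, h3⟩
      exact ⟨⟨s, by simp [h1]; exact ⟨A, h2⟩⟩, h2, h3⟩
    · rintro ⟨s, h2, h3⟩
      exact ⟨s.1, ⟨hsub s, h2⟩, h3⟩
  have hdisj : Pairwise (Function.onFun Disjoint fun s : κ => cell t s.1) := fun s s' hne =>
    disjoint_cell (hsub s) (hsub s') (fun h => hne (Subtype.ext h))
  have hcellfin : ∀ s : κ, ν (cell t s.1) < ∞ := by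
    intro s
    have hs := s.2
    simp only [Finset.mem_filter, Finset.mem_powerset] at hs
    obtain ⟨A, hA⟩ := hs.2
    refine (measure_mono ?_).trans_lt (ht A (hs.1 hA)).2
    exact fun x hx => (hx A (hs.1 hA)).2 hA
  have hmap := hfin κ (fun s => cell t s.1) (fun s => measurableSet_cell htm _) hcellfin hdisj
    ⟨_, hunion B (Finset.mem_insert_self _ _)⟩
  have heval : ∀ A ∈ t, ∀ m : Measure E,
      m A = ∑ s ∈ (Finset.univ.filter fun s : κ => A ∈ s.1), m (cell t s.1) := by
    intro A hA m
    conv_lhs => rw [hunion A hA]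
    exact measure_biUnion_finset (fun i _ j _ hij => hdisj hij)
      (fun i _ => measurableSet_cell htm _)
  let F : Set (κ → ℝ≥0∞) := ⋂ A ∈ u,
    {a | (∑ s ∈ (Finset.univ.filter fun s : κ => (A : Set E) ∈ s.1), a s) ∈ C A}
  have hF : MeasurableSet F := by
    refine u.measurableSet_biInter fun A _ => ?_
    exact (Finset.measurable_sum _ fun s _ => measurable_pi_apply s) (hC A)
  have hset : (⋂ A ∈ u, D A) = (fun (m : Measure E) (s : κ) => m (cell t s.1)) ⁻¹' F := by
    ext m
    simp only [Set.mem_iInter, Set.mem_preimage, F, Set.mem_ofPred_eq]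
    refine forall₂_congr fun A hA => ?_
    rw [hDC A hA, Set.mem_preimage, heval A (by simp [t, hA, A.2.1, A.2.2])]
  rw [hset, ← Measure.map_apply (measurable_eval_family fun s => measurableSet_cell htm _) hF, hmap,
    Measure.map_apply (measurable_eval_family fun s => measurableSet_cell htm _) hF]

end Ext

/-! ### Poisson counts and Poisson laws -/

/-- The Poisson distribution with parameter `a`, as a law on `ℝ≥0∞`. -/
noncomputable def countLaw (a : ℝ≥0∞) : Measure ℝ≥0∞ :=
  (poissonMeasure a.toNNReal).map (fun n : ℕ => (n : ℝ≥0∞))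

instance (a : ℝ≥0∞) : IsProbabilityMeasure (countLaw a) :=
  Measure.isProbabilityMeasure_map (measurable_of_countable _).aemeasurable

lemma lintegral_countLaw {a : ℝ≥0∞} {f : ℝ≥0∞ → ℝ≥0∞} (hf : Measurable f) :
    ∫⁻ x, f x ∂countLaw a = ∑' n : ℕ, f n *
      ENNReal.ofReal (Real.exp (-(a.toNNReal : ℝ)) * (a.toNNReal : ℝ) ^ n / n.factorial) := by
  rw [countLaw, lintegral_map hf (measurable_of_countable _), lintegral_countable']
  simp_rw [poissonMeasure_singleton]

/-- The size-biased Poisson distribution is the Poisson distribution shifted by one. -/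
lemma lintegral_mul_countLaw {a : ℝ≥0∞} (ha : a ≠ ∞) {f : ℝ≥0∞ → ℝ≥0∞} (hf : Measurable f) :
    ∫⁻ x, x * f x ∂countLaw a = a * ∫⁻ x, f (x + 1) ∂countLaw a := by
  lift a to ℝ≥0 using ha
  rw [lintegral_countLaw (f := fun x => x * f x) (by fun_prop), lintegral_countLaw (by fun_prop),
    tsum_eq_zero_add' ENNReal.summable, ← ENNReal.tsum_mul_left]
  simp only [Nat.cast_zero, zero_mul, zero_add, ENNReal.toNNReal_coe]
  refine tsum_congr fun n => ?_
  have h2 : ((n + 1 : ℕ) : ℝ≥0∞) *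
      ENNReal.ofReal (Real.exp (-(a : ℝ)) * (a : ℝ) ^ (n + 1) / (n + 1).factorial) =
      a * ENNReal.ofReal (Real.exp (-(a : ℝ)) * (a : ℝ) ^ n / n.factorial) := by
    rw [← ENNReal.ofReal_natCast, ← ENNReal.ofReal_coe_nnreal, ← ENNReal.ofReal_mul (by positivity),
      ← ENNReal.ofReal_mul (by positivity)]
    congr 1
    rw [Nat.factorial_succ]
    push_cast
    field_simp
    ring
  calc _ = f (n + 1 : ℕ) * (((n + 1 : ℕ) : ℝ≥0∞) * ENNReal.ofReal
        (Real.exp (-(a : ℝ)) * (a : ℝ) ^ (n + 1) / (n + 1).factorial)) := by ring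
    _ = _ := by rw [h2]; push_cast; ring

lemma countLaw_zero_set (a : ℝ≥0∞) :
    countLaw a {0} = ENNReal.ofReal (Real.exp (-a.toReal)) := by
  have := lintegral_countLaw (a := a) (f := Set.indicator {0} 1)
    (measurable_one.indicator (measurableSet_singleton _))
  rw [lintegral_indicator_one (measurableSet_singleton _)] at this
  rw [this, tsum_eq_single 0]
  · simp [ENNReal.coe_toNNReal_eq_toReal]
  · intro n hn
    simp [hn]

/-- `Q` is the law of a Poisson point process with intensity `ν`: the numbers of points in disjoint
sets of finite intensity are independent Poisson variables. -/
structure IsPoissonLaw {E : Type*} [MeasurableSpace E] (ν : Measure E)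
    (Q : Measure (Measure E)) : Prop where
  isProbabilityMeasure : IsProbabilityMeasure Q
  lintegral_prod_fin : ∀ (n : ℕ) (A : Fin n → Set E), (∀ i, MeasurableSet (A i)) →
    (∀ i, ν (A i) < ∞) → Pairwise (Function.onFun Disjoint A) →
    ∀ φ : Fin n → ℝ≥0∞ → ℝ≥0∞, (∀ i, Measurable (φ i)) →
      ∫⁻ m, ∏ i, φ i (m (A i)) ∂Q = ∏ i, ∫⁻ a, φ i a ∂countLaw (ν (A i))

section PoissonLaw

variable {E : Type*} [MeasurableSpace E] {ν : Measure E} {Q : Measure (Measure E)}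

lemma IsPoissonProcess.isPoissonLaw {Ω : Type*} [MeasurableSpace Ω] {P : Measure Ω}
    [IsProbabilityMeasure P] {η : Ω → Measure E} (h : IsPoissonProcess P ν η) :
    IsPoissonLaw ν (P.map η) := by
  refine ⟨Measure.isProbabilityMeasure_map h.measurable.aemeasurable, ?_⟩
  intro n A hA hAν hd φ hφ
  have hm : ∀ i, Measurable fun ω => η ω (A i) := fun i =>
    (Measure.measurable_coe (hA i)).comp h.measurable
  rw [lintegral_map _ h.measurable]
  · have hi : iIndepFun (fun i ω => φ i (η ω (A i))) P := (h.indep n A hA hd).comp φ hφ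
    rw [lintegral_prod_eq_prod_lintegral_of_indepFun _ _ hi (fun i => (hφ i).comp (hm i))]
    refine Finset.prod_congr rfl fun i _ => ?_
    rw [countLaw, ← h.law (A i) (hA i) (hAν i).ne, lintegral_map (hφ i) (hm i)]
  · exact Finset.measurable_prod _ fun i _ => (hφ i).comp (Measure.measurable_coe (hA i))

lemma IsPoissonLaw.lintegral_prod (h : IsPoissonLaw ν Q) {ι : Type*} [Fintype ι] {A : ι → Set E}
    (hA : ∀ i, MeasurableSet (A i)) (hAν : ∀ i, ν (A i) < ∞)
    (hd : Pairwise (Function.onFun Disjoint A)) {φ : ι → ℝ≥0∞ → ℝ≥0∞}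
    (hφ : ∀ i, Measurable (φ i)) :
    ∫⁻ m, ∏ i, φ i (m (A i)) ∂Q = ∏ i, ∫⁻ a, φ i a ∂countLaw (ν (A i)) := by
  let e := (Fintype.equivFin ι).symm
  have := h.lintegral_prod_fin _ (fun i => A (e i)) (fun i => hA _) (fun i => hAν _)
    (fun i j hij => hd (e.injective.ne hij)) (fun i => φ (e i)) (fun i => hφ _)
  rw [e.prod_comp (fun i => ∫⁻ a, φ i a ∂countLaw (ν (A i)))] at this
  rw [← this]
  refine lintegral_congr fun m => ?_
  rw [e.prod_comp (fun i => φ i (m (A i)))]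

lemma IsPoissonLaw.lintegral_count (h : IsPoissonLaw ν Q) {A : Set E} (hA : MeasurableSet A)
    (hAν : ν A < ∞) {φ : ℝ≥0∞ → ℝ≥0∞} (hφ : Measurable φ) :
    ∫⁻ m, φ (m A) ∂Q = ∫⁻ a, φ a ∂countLaw (ν A) := by
  simpa using h.lintegral_prod (ι := Unit) (A := fun _ => A) (fun _ => hA) (fun _ => hAν)
    (fun i j hij => (hij (Subsingleton.elim i j)).elim) (φ := fun _ => φ) (fun _ => hφ)

lemma IsPoissonLaw.lintegral_eval (h : IsPoissonLaw ν Q) {A : Set E} (hA : MeasurableSet A)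
    (hAν : ν A < ∞) : ∫⁻ m, m A ∂Q = ν A := by
  have h1 := h.lintegral_count hA hAν measurable_id
  have h2 := lintegral_mul_countLaw hAν.ne (f := fun _ => 1) measurable_const
  simp only [mul_one, lintegral_const, measure_univ] at h2
  simpa [h2] using h1

lemma measurable_add_dirac :
    Measurable fun p : Measure E × E => p.1 + Measure.dirac p.2 := by
  refine Measure.measurable_of_measurable_coe _ fun s hs => ?_
  simp only [Measure.add_apply]
  exact ((Measure.measurable_coe hs).comp measurable_fst).add
    (((Measure.measurable_coe hs).comp Measure.measurable_dirac).comp measurable_snd)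

lemma prod_indicator_one {ι : Type*} [Fintype ι] (C : ι → Set ℝ≥0∞) (a : ι → ℝ≥0∞) :
    ∏ i, (C i).indicator (1 : ℝ≥0∞ → ℝ≥0∞) (a i) =
      Set.indicator {b : ι → ℝ≥0∞ | ∀ i, b i ∈ C i} (1 : (ι → ℝ≥0∞) → ℝ≥0∞) a := by
  classical
  by_cases h : ∀ i, a i ∈ C i
  · rw [Set.indicator_of_mem (by exact h)]
    simp [h]
  · rw [Set.indicator_of_notMem (by exact h)]
    obtain ⟨i, hi⟩ := not_forall.1 h
    exact Finset.prod_eq_zero (Finset.mem_univ i) (by simp [hi])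

lemma measurableSet_box {ι : Type*} [Fintype ι] {C : ι → Set ℝ≥0∞}
    (hC : ∀ i, MeasurableSet (C i)) : MeasurableSet {b : ι → ℝ≥0∞ | ∀ i, b i ∈ C i} := by
  have : {a : ι → ℝ≥0∞ | ∀ i, a i ∈ C i} = Set.univ.pi C := by ext; simp
  rw [this]; exact MeasurableSet.univ_pi hC

lemma IsPoissonLaw.measure_box (h : IsPoissonLaw ν Q) {ι : Type*} [Fintype ι] {A : ι → Set E}
    (hA : ∀ i, MeasurableSet (A i)) (hAν : ∀ i, ν (A i) < ∞)
    (hd : Pairwise (Function.onFun Disjoint A)) {C : ι → Set ℝ≥0∞}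
    (hC : ∀ i, MeasurableSet (C i)) :
    Q {m | ∀ i, m (A i) ∈ C i} = ∏ i, countLaw (ν (A i)) (C i) := by
  have := h.lintegral_prod hA hAν hd (φ := fun i => (C i).indicator 1)
    (fun i => measurable_one.indicator (hC i))
  simp_rw [lintegral_indicator_one (hC _)] at this
  have hs : MeasurableSet {m : Measure E | ∀ i, m (A i) ∈ C i} :=
    measurable_eval_family hA (measurableSet_box hC)
  rw [← this, ← lintegral_indicator_one hs]
  refine lintegral_congr fun m => ?_
  rw [prod_indicator_one]
  rfl

/-- Mecke's formula for rectangles. -/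
lemma IsPoissonLaw.mecke_rect [SigmaFinite ν] (h : IsPoissonLaw ν Q) {B : Set E}
    (hB : MeasurableSet B) (hBν : ν B < ∞) :
    Q.withDensity (fun m => m B) =
      (Q.prod (ν.restrict B)).map (fun p => p.1 + Measure.dirac p.2) := by
  classical
  have := h.isProbabilityMeasure
  have : IsFiniteMeasure (Q.withDensity (fun m => m B)) :=
    isFiniteMeasure_withDensity (by rw [h.lintegral_eval hB hBν]; exact hBν.ne)
  refine ext_of_disjoint ν hB hBν ?_
  rintro n A hA hAν hd ⟨J, hJ⟩ C hC
  have hF : MeasurableSet {m : Measure E | ∀ i, m (A i) ∈ C i} :=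
    measurable_eval_family hA (measurableSet_box hC)
  have hdJ : Set.PairwiseDisjoint (J : Set (Fin n)) A := fun i _ j _ hij => hd hij
  have hmB : ∀ m : Measure E, m B = ∑ j ∈ J, m (A j) := fun m => by
    rw [hJ]; exact measure_biUnion_finset hdJ (fun i _ => hA i)
  rw [withDensity_apply _ hF, Measure.map_apply measurable_add_dirac hF,
    Measure.prod_apply_symm (measurable_add_dirac hF)]
  -- The factor `m (A j)` size-biases the `j`-th count alone, which for a Poisson variable is a
  -- shift by one. Adding a Dirac mass at a point of `A j` causes the same shift.
  have e1 : ∀ j, ∫⁻ m in {m : Measure E | ∀ i, m (A i) ∈ C i}, m (A j) ∂Q =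
      ν (A j) * ∏ i, ∫⁻ a, (C i).indicator 1 (a + if i = j then 1 else 0)
        ∂countLaw (ν (A i)) := by
    intro j
    rw [← lintegral_indicator hF]
    have : ∀ m : Measure E, Set.indicator {m : Measure E | ∀ i, m (A i) ∈ C i}
        (fun m => m (A j)) m =
        ∏ i, (if i = j then m (A i) else 1) * (C i).indicator 1 (m (A i)) := by
      intro m
      rw [Finset.prod_mul_distrib, prod_indicator_one, Finset.prod_ite_eq' Finset.univ j]
      by_cases hm : ∀ i, m (A i) ∈ C i
      · rw [Set.indicator_of_mem (by exact hm), Set.indicator_of_mem (by exact hm)]; simp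
      · rw [Set.indicator_of_notMem (by exact hm), Set.indicator_of_notMem (by exact hm)]; simp
    simp_rw [this]
    rw [h.lintegral_prod hA hAν hd
      (φ := fun i a => (if i = j then a else 1) * (C i).indicator 1 a) (fun i => by
        refine Measurable.mul ?_ (measurable_one.indicator (hC i))
        by_cases hij : i = j <;> simp [hij, measurable_id', measurable_const])]
    rw [← Finset.mul_prod_erase _ _ (Finset.mem_univ j),
      ← Finset.mul_prod_erase _ _ (Finset.mem_univ j), ← mul_assoc]
    congr 1
    · simp only [if_true]
      exact lintegral_mul_countLaw (hAν j).ne (measurable_one.indicator (hC j))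
    · refine Finset.prod_congr rfl fun i hi => ?_
      simp [(Finset.mem_erase.1 hi).1]
  simp_rw [hmB]
  rw [lintegral_finsetSum' _ fun j _ => (Measure.measurable_coe (hA j)).aemeasurable]
  conv_rhs => rw [hJ]
  rw [lintegral_biUnion_finset hdJ (fun i _ => hA i)]
  refine Finset.sum_congr rfl fun j _ => ?_
  rw [e1 j]
  have : ∀ x ∈ A j, Q ((fun m => (m, x)) ⁻¹' ((fun p : Measure E × E =>
      p.1 + Measure.dirac p.2) ⁻¹' {m | ∀ i, m (A i) ∈ C i})) =
      ∏ i, ∫⁻ a, (C i).indicator 1 (a + if i = j then 1 else 0) ∂countLaw (ν (A i)) := by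
    intro x hx
    have hxi : ∀ i, Measure.dirac x (A i) = if i = j then 1 else 0 := by
      intro i
      rw [Measure.dirac_apply' _ (hA i)]
      by_cases hij : i = j
      · subst hij; simp [hx]
      · have : x ∉ A i := fun hx' => Set.disjoint_left.1 (hd hij) hx' hx
        simp [hij, this]
    rw [← h.lintegral_prod hA hAν hd
      (φ := fun i a => (C i).indicator 1 (a + if i = j then 1 else 0)) (fun i =>
        (measurable_one.indicator (hC i)).comp (measurable_id.add_const _)),
      ← lintegral_indicator_one (by
        exact (measurable_add_dirac.comp (measurable_id.prodMk measurable_const)) hF)]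
    refine lintegral_congr fun m => ?_
    rw [prod_indicator_one C (fun i => m (A i) + if i = j then 1 else 0)]
    simp only [Set.indicator, Set.mem_preimage, Set.mem_ofPred_eq, Measure.add_apply, hxi,
      Pi.one_apply]
  rw [setLIntegral_congr_fun (hA j) this, lintegral_const, Measure.restrict_apply MeasurableSet.univ,
    Set.univ_inter, mul_comm]

/-- Restricting a Poisson process to `V`, then mapping it by `h` which sends `ν|_V` to `ν`, gives a
Poisson process with the same law, independent of the configuration in `R`, disjoint from `V`. -/
theorem IsPoissonLaw.lintegral_map_restrict [SigmaFinite ν] (h : IsPoissonLaw ν Q) {R V : Set E}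
    (hR : MeasurableSet R) (hRν : ν R < ∞) (hV : MeasurableSet V) (hRV : Disjoint R V)
    {θ : E → E} (hθ : Measurable θ) (hνθ : (ν.restrict V).map θ = ν)
    {F : Measure E → ℝ≥0∞} (hF : Measurable F) :
    ∫⁻ m in {m | m R = 0}, F ((m.restrict V).map θ) ∂Q =
      ENNReal.ofReal (Real.exp (-(ν R).toReal)) * ∫⁻ m, F m ∂Q := by
  have := h.isProbabilityMeasure
  have hres : Measurable fun m : Measure E => (m.restrict V).map θ := by
    refine (Measure.measurable_map θ hθ).comp ?_
    refine Measure.measurable_of_measurable_coe _ fun s hs => ?_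
    simp_rw [Measure.restrict_apply hs]
    exact Measure.measurable_coe (hs.inter hV)
  have hR0 : MeasurableSet {m : Measure E | m R = 0} :=
    Measure.measurable_coe hR (measurableSet_singleton 0)
  have key : (Q.restrict {m | m R = 0}).map (fun m => (m.restrict V).map θ) =
      ENNReal.ofReal (Real.exp (-(ν R).toReal)) • Q := by
    -- No set has to be decomposed here, so the empty set plays the role of `B`.
    refine ext_of_disjoint ν MeasurableSet.empty (by simp) ?_
    rintro n A hA hAν hd - C hC
    have hA' : ∀ i, MeasurableSet (θ ⁻¹' A i ∩ V) := fun i => (hθ (hA i)).inter hV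
    have hmass : ∀ i, ν (θ ⁻¹' A i ∩ V) = ν (A i) := by
      intro i
      conv_rhs => rw [← hνθ]
      rw [Measure.map_apply hθ (hA i), Measure.restrict_apply (hθ (hA i))]
    have hbox : MeasurableSet {m : Measure E | ∀ i, m (A i) ∈ C i} :=
      measurable_eval_family hA (measurableSet_box hC)
    rw [Measure.map_apply hres hbox, Measure.restrict_apply (hres hbox), Measure.smul_apply,
      h.measure_box hA hAν hd hC, smul_eq_mul, ← countLaw_zero_set]
    -- `R` is adjoined as one more disjoint set with prescribed count zero. A single use of the
    -- independence of counts then gives both the void probability and the law of the mapped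
    -- configuration.
    let A' : Option (Fin n) → Set E := fun o => o.elim R fun i => θ ⁻¹' A i ∩ V
    let C' : Option (Fin n) → Set ℝ≥0∞ := fun o => o.elim {0} C
    have := h.measure_box (A := A') (C := C') ?_ ?_ ?_ ?_
    · rw [Fintype.prod_option] at this
      simp only [A', C', Option.elim, hmass] at this
      rw [← this]
      congr 1
      ext m
      simp only [Set.mem_inter_iff, Set.mem_preimage, Set.mem_ofPred_eq, Option.forall]
      rw [and_comm]
      refine and_congr Iff.rfl (forall_congr' fun i => ?_)
      rw [Measure.map_apply hθ (hA i), Measure.restrict_apply (hθ (hA i))]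
    · rintro (_ | i)
      exacts [hR, hA' i]
    · rintro (_ | i)
      exacts [hRν, (hmass i).trans_lt (hAν i)]
    · rintro (_ | i) (_ | j) hij
      · exact (hij rfl).elim
      · exact hRV.mono_right Set.inter_subset_right
      · exact (hRV.mono_right Set.inter_subset_right).symm
      · exact ((hd (fun h => hij (by rw [h]))).preimage θ).mono Set.inter_subset_left
          Set.inter_subset_left
    · rintro (_ | i)
      exacts [measurableSet_singleton 0, hC i]
  rw [← lintegral_map hF hres, key, lintegral_smul_measure, smul_eq_mul]

end PoissonLaw

/-! ### Configurations as an s-finite kernel, and Mecke's formula -/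

section ConfigKernel

variable {E : Type*} [MeasurableSpace E]

lemma measurable_restrict_measure {D : Set E} (hD : MeasurableSet D) :
    Measurable fun m : Measure E => m.restrict D := by
  refine Measure.measurable_of_measurable_coe _ fun s hs => ?_
  simp_rw [Measure.restrict_apply hs]
  exact Measure.measurable_coe (hs.inter hD)

open Classical in
/-- The kernel sending a measure `m` with `m D ∈ [j, j + 1)` to its restriction to `D`. -/
noncomputable def truncKernel (D : Set E) (hD : MeasurableSet D) (j : ℕ) :
    Kernel (Measure E) E where
  toFun m := if m D ∈ Set.Ico (j : ℝ≥0∞) (j + 1) then m.restrict D else 0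
  measurable' := Measurable.ite (Measure.measurable_coe hD measurableSet_Ico)
    (measurable_restrict_measure hD) measurable_const

instance (D : Set E) (hD : MeasurableSet D) (j : ℕ) : IsFiniteKernel (truncKernel D hD j) := by
  refine ⟨⟨j + 1, by finiteness, fun m => ?_⟩⟩
  change (if m D ∈ Set.Ico (j : ℝ≥0∞) (j + 1) then m.restrict D else 0) Set.univ ≤ j + 1
  split_ifs with h
  · simpa using h.2.le
  · simp

/-- A cell of a countable partition into sets of finite `ν`-measure. -/
def finiteCell (ν : Measure E) [SigmaFinite ν] (k : ℕ) : Set E :=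
  disjointed (spanningSets ν) k

lemma measurableSet_finiteCell (ν : Measure E) [SigmaFinite ν] (k : ℕ) :
    MeasurableSet (finiteCell ν k) :=
  MeasurableSet.disjointed (measurableSet_spanningSets ν) k

lemma measure_finiteCell_lt_top (ν : Measure E) [SigmaFinite ν] (k : ℕ) :
    ν (finiteCell ν k) < ∞ :=
  (measure_mono (disjointed_subset _ _)).trans_lt (measure_spanningSets_lt_top ν k)

lemma pairwise_disjoint_finiteCell (ν : Measure E) [SigmaFinite ν] :
    Pairwise (Function.onFun Disjoint (finiteCell ν)) :=
  disjoint_disjointed _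

lemma iUnion_finiteCell (ν : Measure E) [SigmaFinite ν] : ⋃ k, finiteCell ν k = Set.univ := by
  simp only [finiteCell]
  rw [iUnion_disjointed, iUnion_spanningSets]

/-- Measures that are finite on each cell of the fixed `ν`-finite partition. -/
def IsConfig (ν : Measure E) [SigmaFinite ν] (m : Measure E) : Prop :=
  ∀ k, m (finiteCell ν k) < ∞

/-- An s-finite kernel that maps each `m` satisfying `IsConfig ν m` to itself. -/
noncomputable def configKernel (ν : Measure E) [SigmaFinite ν] : Kernel (Measure E) E :=
  Kernel.sum fun p : ℕ × ℕ => truncKernel (finiteCell ν p.1) (measurableSet_finiteCell ν p.1) p.2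

instance (ν : Measure E) [SigmaFinite ν] : IsSFiniteKernel (configKernel ν) :=
  Kernel.isSFiniteKernel_sum

/-- A general measure need not be s-finite, so the identity cannot serve directly as an s-finite
kernel. On each cell of finite mass exactly one truncation is nonzero, the one at the integer part
of that mass, and the cells then add up to `m`. -/
lemma configKernel_apply {ν : Measure E} [SigmaFinite ν] {m : Measure E} (hm : IsConfig ν m) :
    configKernel ν m = m := by
  classical
  ext s hs
  rw [configKernel, Kernel.sum_apply' _ _ hs,
    ENNReal.tsum_prod (f := fun k j =>
      truncKernel (finiteCell ν k) (measurableSet_finiteCell ν k) j m s)]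
  have : ∀ k, ∑' j, truncKernel (finiteCell ν k) (measurableSet_finiteCell ν k) j m s =
      m (s ∩ finiteCell ν k) := by
    intro k
    have hk := hm k
    obtain ⟨a, ha⟩ : ∃ a, a = m (finiteCell ν k) := ⟨_, rfl⟩
    rw [← ha] at hk
    have hfl : a ∈ Set.Ico (⌊a.toNNReal⌋₊ : ℝ≥0∞) (⌊a.toNNReal⌋₊ + 1) := by
      lift a to ℝ≥0 using hk.ne
      simp only [ENNReal.toNNReal_coe, Set.mem_Ico]
      constructor
      · exact_mod_cast Nat.floor_le a.2
      · exact_mod_cast Nat.lt_floor_add_one a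
    rw [tsum_eq_single ⌊a.toNNReal⌋₊]
    · change (if m (finiteCell ν k) ∈ Set.Ico _ _ then m.restrict (finiteCell ν k) else 0) s = _
      rw [if_pos (by rw [← ha]; exact hfl), Measure.restrict_apply hs]
    · intro j hj
      change (if m (finiteCell ν k) ∈ Set.Ico _ _ then m.restrict (finiteCell ν k) else 0) s = _
      rw [if_neg, Measure.coe_zero, Pi.zero_apply]
      rintro ⟨h1, h2⟩
      apply hj
      rw [← ha] at h1 h2
      lift a to ℝ≥0 using hk.ne
      refine ((Nat.floor_eq_iff (zero_le)).2 ⟨?_, ?_⟩).symm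
      · exact_mod_cast h1
      · exact_mod_cast h2
  simp_rw [this]
  rw [← measure_iUnion, ← Set.inter_iUnion, iUnion_finiteCell, Set.inter_univ]
  · exact fun i j hij => (pairwise_disjoint_finiteCell ν hij).mono Set.inter_subset_right
      Set.inter_subset_right
  · exact fun k => hs.inter (measurableSet_finiteCell ν k)

lemma IsConfig.add_dirac {ν : Measure E} [SigmaFinite ν] {m : Measure E} (hm : IsConfig ν m)
    (x : E) : IsConfig ν (m + Measure.dirac x) := by
  intro k
  rw [Measure.add_apply]
  exact ENNReal.add_lt_top.2 ⟨hm k, prob_le_one.trans_lt ENNReal.one_lt_top⟩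

variable {ν : Measure E} {Q : Measure (Measure E)}

lemma IsPoissonLaw.ae_isConfig [SigmaFinite ν] (h : IsPoissonLaw ν Q) :
    ∀ᵐ m ∂Q, IsConfig ν m := by
  refine ae_all_iff.2 fun k => ae_lt_top (Measure.measurable_coe (measurableSet_finiteCell ν k)) ?_
  rw [h.lintegral_eval (measurableSet_finiteCell ν k) (measure_finiteCell_lt_top ν k)]
  exact (measure_finiteCell_lt_top ν k).ne

/-- Null sets of the intensity are almost surely not charged. -/
lemma IsPoissonLaw.ae_eval_eq_zero (h : IsPoissonLaw ν Q) {A : Set E} (hA : MeasurableSet A)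
    (hAν : ν A = 0) : ∀ᵐ m ∂Q, m A = 0 := by
  refine (lintegral_eq_zero_iff (Measure.measurable_coe hA)).1 ?_
  rw [h.lintegral_eval hA (by simp [hAν]), hAν]

/-- **Mecke's formula**. -/
theorem IsPoissonLaw.mecke [SigmaFinite ν] (h : IsPoissonLaw ν Q)
    {Φ : Measure E × E → ℝ≥0∞} (hΦ : Measurable Φ) :
    ∫⁻ m, ∫⁻ x, Φ (m, x) ∂(configKernel ν m) ∂Q =
      ∫⁻ x, ∫⁻ m, Φ (m + Measure.dirac x, x) ∂Q ∂ν := by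
  have := h.isProbabilityMeasure
  have hadd : Measurable fun p : Measure E × E => (p.1 + Measure.dirac p.2, p.2) :=
    measurable_add_dirac.prodMk measurable_snd
  have key : Q ⊗ₘ configKernel ν = (Q.prod ν).map (fun p => (p.1 + Measure.dirac p.2, p.2)) := by
    -- On each slab over a `ν`-finite cell the left side is a finite measure, so agreement on
    -- rectangles, which is `mecke_rect`, suffices.
    refine Measure.ext_of_iUnion_eq_univ (s := fun k => Set.univ ×ˢ finiteCell ν k) ?_ fun k => ?_
    · rw [← Set.prod_iUnion, iUnion_finiteCell, Set.univ_prod_univ]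
    have hk := measurableSet_finiteCell ν k
    have hrect : ∀ {F : Set (Measure E)} {B : Set E}, MeasurableSet F → MeasurableSet B →
        ((Q ⊗ₘ configKernel ν).restrict (Set.univ ×ˢ finiteCell ν k)) (F ×ˢ B) =
        (((Q.prod ν).map (fun p => (p.1 + Measure.dirac p.2, p.2))).restrict
          (Set.univ ×ˢ finiteCell ν k)) (F ×ˢ B) := by
      intro F B hF hB
      have hBk := hB.inter hk
      have hlt : ν (B ∩ finiteCell ν k) < ∞ :=
        (measure_mono Set.inter_subset_right).trans_lt (measure_finiteCell_lt_top ν k)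
      rw [Measure.restrict_apply (hF.prod hB), Measure.restrict_apply (hF.prod hB),
        Set.prod_inter_prod, Set.inter_univ, Measure.compProd_apply_prod hF hBk,
        Measure.map_apply hadd (hF.prod hBk)]
      have hres : Q.prod (ν.restrict (B ∩ finiteCell ν k)) =
          (Q.prod ν).restrict (Set.univ ×ˢ (B ∩ finiteCell ν k)) := by
        rw [← Measure.prod_restrict, Measure.restrict_univ]
      have h1 : ∫⁻ m in F, m (B ∩ finiteCell ν k) ∂Q =
          (Q.prod ν) ((fun p => p.1 + Measure.dirac p.2) ⁻¹' F ∩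
            Set.univ ×ˢ (B ∩ finiteCell ν k)) := by
        rw [← withDensity_apply _ hF, h.mecke_rect hBk hlt,
          Measure.map_apply measurable_add_dirac hF, hres,
          Measure.restrict_apply (measurable_add_dirac hF)]
      rw [lintegral_congr_ae (g := fun m => m (B ∩ finiteCell ν k)), h1]
      · congr 1
        ext p
        simp
      · filter_upwards [ae_restrict_of_ae h.ae_isConfig] with m hm
        rw [configKernel_apply hm]
    have hfinite : IsFiniteMeasure
        ((Q ⊗ₘ configKernel ν).restrict (Set.univ ×ˢ finiteCell ν k)) := by
      refine ⟨?_⟩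
      have hlt := measure_finiteCell_lt_top ν k
      rw [Measure.restrict_apply MeasurableSet.univ, Set.univ_inter,
        Measure.compProd_apply_prod MeasurableSet.univ hk, Measure.restrict_univ,
        lintegral_congr_ae (g := fun m => m (finiteCell ν k)), h.lintegral_eval hk hlt]
      · exact hlt
      · filter_upwards [h.ae_isConfig] with m hm
        rw [configKernel_apply hm]
    exact Measure.ext_prod fun hs ht => hrect hs ht
  rw [← Measure.lintegral_compProd hΦ, key, lintegral_map hΦ hadd,
    
    lintegral_prod_symm (fun p : Measure E × E => Φ (p.1 + Measure.dirac p.2, p.2))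
      (hΦ.comp hadd).aemeasurable]

end ConfigKernel

/-! ### Regions under multiples of a density -/

/-- The intensity `μ ⊗ dv` on `S × ℝ`, carried by `v ≥ 0`. -/
noncomputable abbrev intensity {S : Type*} [MeasurableSpace S] (μ : Measure S) :
    Measure (S × ℝ) :=
  μ.prod (volume.restrict (Set.Ici (0 : ℝ)))

section Geometry

variable {S : Type*}

/-- The points on or below the graph of `t f`. -/
def region (f : S → ℝ≥0) (t : ℝ) : Set (S × ℝ) := {p | p.2 ≤ t * f p.1}

/-- The multiple of `f` whose graph passes through `p`. -/
noncomputable def height (f : S → ℝ≥0) (p : S × ℝ) : ℝ := p.2 / f p.1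

/-- Translation upwards by the function `t f`. -/
def raise (f : S → ℝ≥0) (t : ℝ) (p : S × ℝ) : S × ℝ := (p.1, p.2 + t * f p.1)

/-- Translation downwards by the function `t f`. -/
def lower (f : S → ℝ≥0) (t : ℝ) (p : S × ℝ) : S × ℝ := (p.1, p.2 - t * f p.1)

lemma region_mono (f : S → ℝ≥0) : Monotone (region f) := fun _ _ h p hp =>
  le_trans (show p.2 ≤ _ from hp) (mul_le_mul_of_nonneg_right h (f p.1).2)

lemma mem_region_height {f : S → ℝ≥0} {p : S × ℝ} (hp : 0 < f p.1) {t : ℝ} :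
    p ∈ region f t ↔ height f p ≤ t := by
  have : (0 : ℝ) < f p.1 := hp
  exact (div_le_iff₀ this).symm

variable [MeasurableSpace S]

/-- The points whose graph `t f` is the first one, as `t` increases, under which there is a
point of `m`. -/
def candidates (f : S → ℝ≥0) (m : Measure (S × ℝ)) : Set (S × ℝ) :=
  {p | 0 < f p.1 ∧ 0 < p.2 ∧ m (region f (height f p)) = 1}

/-- The configuration strictly above the graph of `t f`, seen from this graph. -/
noncomputable def residual (f : S → ℝ≥0) (t : ℝ) (m : Measure (S × ℝ)) : Measure (S × ℝ) :=
  (m.restrict (region f t)ᶜ).map (lower f t)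

/-- The regions increase with `t`, so the possibly uncountable union is either its largest member or
an increasing union over rational heights, where continuity from below applies. -/
lemma measure_biUnion_region_le {f : S → ℝ≥0} {m : Measure (S × ℝ)} {T : Set ℝ} {c : ℝ≥0∞}
    (hT : ∀ t ∈ T, m (region f t) ≤ c) : m (⋃ t ∈ T, region f t) ≤ c := by
  by_cases hmax : ∃ t ∈ T, ∀ s ∈ T, s ≤ t
  · obtain ⟨t, ht, hts⟩ := hmax
    exact (measure_mono (Set.iUnion₂_subset fun s hs => region_mono f (hts s hs))).trans (hT t ht)
  · push Not at hmax
    let I := {q : ℚ // ∃ t ∈ T, (q : ℝ) ≤ t}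
    have hsub : (⋃ t ∈ T, region f t) ⊆ ⋃ q : I, region f (q.1 : ℝ) := by
      refine Set.iUnion₂_subset fun t ht => ?_
      obtain ⟨s, hs, hts⟩ := hmax t ht
      obtain ⟨q, hq1, hq2⟩ := exists_rat_btwn hts
      exact (region_mono f hq1.le).trans
        (Set.subset_iUnion (fun q : I => region f (q.1 : ℝ)) ⟨q, s, hs, hq2.le⟩)
    refine (measure_mono hsub).trans ?_
    have hmono : Monotone fun q : I => region f (q.1 : ℝ) := fun q q' h =>
      region_mono f (by exact_mod_cast h)
    rw [hmono.measure_iUnion]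
    exact iSup_le fun q => by
      obtain ⟨t, ht, hqt⟩ := q.2
      exact (measure_mono (region_mono f hqt)).trans (hT t ht)

/-- Each candidate lies in the region of its own height, which has mass one, and these regions are
nested. -/
lemma measure_candidates_le (f : S → ℝ≥0) (m : Measure (S × ℝ)) : m (candidates f m) ≤ 1 := by
  refine (measure_mono (t := ⋃ t ∈ {t | m (region f t) = 1}, region f t) ?_).trans
    (measure_biUnion_region_le fun t ht => le_of_eq ht)
  intro p hp
  exact Set.mem_biUnion (x := height f p) hp.2.2 ((mem_region_height hp.1).2 le_rfl)

section Measurability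

variable {μ : Measure S} [SigmaFinite μ] {f : S → ℝ≥0}

lemma measurableSet_region (hf : Measurable f) (t : ℝ) : MeasurableSet (region f t) :=
  measurableSet_le measurable_snd (by fun_prop)

lemma measurable_height (hf : Measurable f) : Measurable (height f) := by
  unfold height; fun_prop

lemma measurable_raise (hf : Measurable f) (t : ℝ) : Measurable (raise f t) := by
  unfold raise; fun_prop

lemma measurable_lower (hf : Measurable f) (t : ℝ) : Measurable (lower f t) := by
  unfold lower; fun_prop

/-- Evaluating a random measure at a set that itself varies with the parameter is measurable for
s-finite kernels. This is the purpose of `configKernel`: the candidates and the residual both depend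
on the configuration being measured. -/
lemma measurable_config_apply {α E : Type*} [MeasurableSpace α] [MeasurableSpace E]
    {ν : Measure E} [SigmaFinite ν] {h : α → Measure E} (hh : Measurable h) {D : α → Set E}
    (hD : MeasurableSet {p : α × E | p.2 ∈ D p.1}) :
    Measurable fun a => configKernel ν (h a) (D a) :=
  Kernel.measurable_kernel_prodMk_left (κ := (configKernel ν).comap h hh) hD

variable {α : Type*} [MeasurableSpace α] {F : α → S → ℝ≥0} {h : α → Measure (S × ℝ)} {t : α → ℝ}

lemma measurable_config_region (hF : Measurable (Function.uncurry F)) (hh : Measurable h)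
    (ht : Measurable t) :
    Measurable fun a => configKernel (intensity μ) (h a) (region (F a) (t a)) := by
  refine measurable_config_apply hh ?_
  have : Measurable fun p : α × S × ℝ => F p.1 p.2.1 :=
    hF.comp (measurable_fst.prodMk measurable_snd.fst)
  change MeasurableSet {p : α × S × ℝ | p.2.2 ≤ t p.1 * F p.1 p.2.1}
  exact measurableSet_le (by fun_prop) (by fun_prop)

lemma measurableSet_config_candidates (hF : Measurable (Function.uncurry F)) (hh : Measurable h) :
    MeasurableSet {p : α × (S × ℝ) |
      p.2 ∈ candidates (F p.1) (configKernel (intensity μ) (h p.1))} := by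
  have hF' : Measurable fun p : α × S × ℝ => F p.1 p.2.1 :=
    hF.comp (measurable_fst.prodMk measurable_snd.fst)
  refine (measurableSet_lt measurable_const hF').inter
    ((measurableSet_lt measurable_const measurable_snd.snd).inter ?_)
  have : Measurable fun p : α × S × ℝ => height (F p.1) p.2 := by
    unfold height; fun_prop
  refine measurable_config_region (α := α × S × ℝ) (F := fun p => F p.1) (h := fun p => h p.1)
    (t := fun p => height (F p.1) p.2) ?_ (hh.comp measurable_fst) this (measurableSet_singleton 1)
  exact hF.comp (measurable_fst.fst.prodMk measurable_snd)

lemma measurable_config_restrict_candidates (hF : Measurable (Function.uncurry F))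
    (hh : Measurable h) :
    Measurable fun a => (configKernel (intensity μ) (h a)).restrict
      (candidates (F a) (configKernel (intensity μ) (h a))) := by
  refine Measure.measurable_of_measurable_coe _ fun s hs => ?_
  simp_rw [Measure.restrict_apply hs]
  exact measurable_config_apply hh
    ((measurable_snd hs).inter (measurableSet_config_candidates hF hh))

lemma measurable_config_residual (hF : Measurable (Function.uncurry F)) (hh : Measurable h)
    (ht : Measurable t) :
    Measurable fun a => residual (F a) (t a) (configKernel (intensity μ) (h a)) := by
  have hFa : ∀ a, Measurable (F a) := fun a => hF.comp measurable_prodMk_left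
  have hF' : Measurable fun p : α × S × ℝ => F p.1 p.2.1 :=
    hF.comp (measurable_fst.prodMk measurable_snd.fst)
  refine Measure.measurable_of_measurable_coe _ fun s hs => ?_
  have : ∀ a, residual (F a) (t a) (configKernel (intensity μ) (h a)) s =
      configKernel (intensity μ) (h a) (lower (F a) (t a) ⁻¹' s ∩ (region (F a) (t a))ᶜ) := by
    intro a
    rw [residual, Measure.map_apply (measurable_lower (hFa a) _) hs,
      Measure.restrict_apply (measurable_lower (hFa a) _ hs)]
  simp_rw [this]
  refine measurable_config_apply hh (MeasurableSet.inter ?_ (MeasurableSet.compl ?_))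
  · have : Measurable fun p : α × S × ℝ => lower (F p.1) (t p.1) p.2 := by
      unfold lower; fun_prop
    exact this hs
  · exact measurableSet_le (by fun_prop) (by fun_prop)

lemma measurable_config_map_raise (hF : Measurable (Function.uncurry F)) (hh : Measurable h)
    (ht : Measurable t) :
    Measurable fun a => (configKernel (intensity μ) (h a)).map (raise (F a) (t a)) := by
  have hFa : ∀ a, Measurable (F a) := fun a => hF.comp measurable_prodMk_left
  have hF' : Measurable fun p : α × S × ℝ => F p.1 p.2.1 :=
    hF.comp (measurable_fst.prodMk measurable_snd.fst)
  refine Measure.measurable_of_measurable_coe _ fun s hs => ?_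
  simp_rw [fun a => Measure.map_apply (μ := configKernel (intensity μ) (h a))
    (measurable_raise (hFa a) (t a)) hs]
  refine measurable_config_apply hh ?_
  have : Measurable fun p : α × S × ℝ => raise (F p.1) (t p.1) p.2 := by
    unfold raise; fun_prop
  exact this hs

end Measurability

end Geometry

/-! ### Intensity under a graph and the exponential change of variables -/

section OneStep

variable {S : Type*} [MeasurableSpace S] {μ : Measure S} {f : S → ℝ≥0}

/-- The fibre over `z` has length `t f(z)`, and `f` integrates to one. Consequently the void
probability of the region is `exp (-t)`, the source of the exponential marks. -/
lemma intensity_region (hf : Measurable f) (hf1 : ∫⁻ z, f z ∂μ = 1) {t : ℝ} (ht : 0 ≤ t) :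
    intensity μ (region f t) = ENNReal.ofReal t := by
  rw [intensity, Measure.prod_apply (measurableSet_region hf t)]
  have : ∀ z, volume.restrict (Set.Ici (0 : ℝ)) (Prod.mk z ⁻¹' region f t) =
      ENNReal.ofReal t * f z := by
    intro z
    have : Prod.mk z ⁻¹' region f t = Set.Iic (t * f z) := rfl
    rw [this, Measure.restrict_apply measurableSet_Iic, Set.inter_comm, Set.Ici_inter_Iic,
      Real.volume_Icc, sub_zero, ENNReal.ofReal_mul ht, ENNReal.ofReal_coe_nnreal]
  simp_rw [this]
  rw [lintegral_const_mul _ (by fun_prop), hf1, mul_one]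

/-- On each fibre, translation invariance of Lebesgue measure carries the half-line above `t f(z)`
to the positive half-line. The endpoint `0` is null. -/
lemma map_lower_intensity (hf : Measurable f) {t : ℝ} (ht : 0 ≤ t) :
    ((intensity μ).restrict (region f t)ᶜ).map (lower f t) = intensity μ := by
  ext s hs
  have hl := measurable_lower hf t
  have hm := (hl hs).inter (measurableSet_region hf t).compl
  rw [Measure.map_apply hl hs, Measure.restrict_apply (hl hs), intensity, Measure.prod_apply hm,
    Measure.prod_apply hs]
  refine lintegral_congr fun z => ?_
  have hz : 0 ≤ t * (f z : ℝ) := mul_nonneg ht (f z).2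
  have e1 : volume.restrict (Set.Ici (0 : ℝ)) (Prod.mk z ⁻¹' s) =
      volume ((Prod.mk z ⁻¹' s) ∩ Set.Ioi 0) := by
    rw [← Measure.restrict_congr_set Ioi_ae_eq_Ici, Measure.restrict_apply (measurable_prodMk_left hs)]
  rw [e1, Measure.restrict_apply (measurable_prodMk_left hm),
    ← (measurePreserving_sub_right volume (t * (f z : ℝ))).measure_preimage
      ((measurable_prodMk_left hs).inter measurableSet_Ioi).nullMeasurableSet]
  congr 1
  ext v
  simp only [lower, region, Set.mem_inter_iff, Set.mem_preimage, Set.mem_compl_iff,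
    Set.mem_ofPred_eq, Set.mem_Ici, Set.mem_Ioi, not_le, sub_pos]
  constructor
  · rintro ⟨⟨h1, h2⟩, -⟩; exact ⟨h1, h2⟩
  · rintro ⟨h1, h2⟩; exact ⟨⟨h1, h2⟩, hz.trans h2.le⟩

lemma lintegral_expMeasure_one {F : ℝ → ℝ≥0∞} (hF : Measurable F) :
    ∫⁻ t, F t ∂expMeasure 1 = ∫⁻ t in Set.Ioi 0, ENNReal.ofReal (Real.exp (-t)) * F t := by
  have : expMeasure 1 = volume.withDensity (exponentialPDF 1) := rfl
  have hm : Measurable (exponentialPDF 1) := (measurable_exponentialPDFReal 1).ennreal_ofReal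
  rw [this, lintegral_withDensity_eq_lintegral_mul _ hm hF, restrict_Ioi_eq_restrict_Ici,
    ← lintegral_indicator measurableSet_Ici]
  refine lintegral_congr fun t => ?_
  by_cases ht : 0 ≤ t
  · rw [Set.indicator_of_mem (by exact ht), Pi.mul_apply, exponentialPDF_of_nonneg ht]
    simp
  · rw [Set.indicator_of_notMem (by exact ht), Pi.mul_apply,
      exponentialPDF_of_neg (not_le.1 ht), zero_mul]

/-- The change of variables `v = c t`. -/
lemma lintegral_exp_div {c : ℝ≥0} (hc : 0 < c) {F : ℝ → ℝ≥0∞} (hF : Measurable F) :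
    ∫⁻ v in Set.Ioi (0 : ℝ), ENNReal.ofReal (Real.exp (-(v / c))) * F (v / c) =
      c * ∫⁻ t, F t ∂expMeasure 1 := by
  have hc' : (0 : ℝ) < c := hc
  rw [lintegral_expMeasure_one hF]
  let H : ℝ → ℝ≥0∞ := (Set.Ioi 0).indicator fun t => ENNReal.ofReal (Real.exp (-t)) * F t
  have hH : Measurable H := Measurable.indicator (by fun_prop) measurableSet_Ioi
  have h0 : Measure.map ((c : ℝ)⁻¹ * ·) volume = (c : ℝ≥0∞) • (volume : Measure ℝ) := by
    rw [Real.map_volume_mul_left (inv_ne_zero hc'.ne'), inv_inv, abs_of_pos hc',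
      ENNReal.ofReal_coe_nnreal]
  have h1 : ∫⁻ v, H ((c : ℝ)⁻¹ * v) = c * ∫⁻ t, H t := by
    rw [← lintegral_map hH (measurable_const_mul _), h0, lintegral_smul_measure, smul_eq_mul]
  rw [← lintegral_indicator measurableSet_Ioi, ← lintegral_indicator measurableSet_Ioi, ← h1]
  refine lintegral_congr fun v => ?_
  have : 0 < (c : ℝ)⁻¹ * v ↔ 0 < v := by
    rw [mul_pos_iff_of_pos_left (inv_pos.2 hc')]
  simp only [H, Set.indicator, Set.mem_Ioi, this]
  rw [div_eq_inv_mul]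

end OneStep

/-! ### The law of the first point met -/

section FirstPoint

variable {S : Type*} [MeasurableSpace S] {μ : Measure S} [SigmaFinite μ] {f : S → ℝ≥0}
  {Q : Measure (Measure (S × ℝ))}

/-- The point `p` lies on the graph through itself and already contributes mass one, so nothing is
left for `m` on or below that graph. -/
lemma mem_candidates_add_dirac (hf : Measurable f) {m : Measure (S × ℝ)} {p : S × ℝ}
    (hp : 0 < f p.1) (hp2 : 0 < p.2) :
    p ∈ candidates f (m + Measure.dirac p) ↔ m (region f (height f p)) = 0 := by
  have : p ∈ region f (height f p) := (mem_region_height hp).2 le_rfl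
  simp only [candidates, Set.mem_ofPred_eq, hp, hp2, true_and, Measure.add_apply,
    Measure.dirac_apply' _ (measurableSet_region hf _), Set.indicator_of_mem this, Pi.one_apply]
  constructor
  · intro h
    by_contra h0
    have := ENNReal.lt_add_right (a := 1) (by simp) h0
    rw [add_comm, h] at this
    exact this.false
  · intro h; simp [h]

lemma residual_add_dirac (hf : Measurable f) {m : Measure (S × ℝ)} {p : S × ℝ}
    (hp : 0 < f p.1) :
    residual f (height f p) (m + Measure.dirac p) = residual f (height f p) m := by
  have h : p ∉ (region f (height f p))ᶜ := fun h => h ((mem_region_height hp).2 le_rfl)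
  classical
  rw [residual, Measure.restrict_add,
    restrict_dirac' (measurableSet_region hf _).compl, if_neg h, add_zero, residual]

lemma measurable_uncurry_const {α : Type*} [MeasurableSpace α] (hf : Measurable f) :
    Measurable (Function.uncurry fun _ : α => f) :=
  hf.comp measurable_snd

lemma measurableSet_candidates (hf : Measurable f) {m : Measure (S × ℝ)}
    (hm : IsConfig (intensity μ) m) : MeasurableSet (candidates f m) := by
  have := measurable_prodMk_left (x := m) (measurableSet_config_candidates (μ := μ)
    (F := fun _ : Measure (S × ℝ) => f) (measurable_uncurry_const hf) measurable_id)
  simp only [Set.preimage_ofPred_eq, id, configKernel_apply hm] at this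
  exact this

/-- The joint law of the candidate points and of the configuration above the graph through them. -/
lemma IsPoissonLaw.lintegral_candidates (h : IsPoissonLaw (intensity μ) Q) (hf : Measurable f)
    (hf1 : ∫⁻ z, f z ∂μ = 1) {F : (S × ℝ) × Measure (S × ℝ) → ℝ≥0∞} (hF : Measurable F) :
    ∫⁻ m, ∫⁻ p in candidates f m, F ((p.1, height f p), residual f (height f p) m) ∂m ∂Q =
      ∫⁻ w, F w ∂((μ.withDensity fun z => f z).prod (expMeasure 1)).prod Q := by
  have := h.isProbabilityMeasure
  have := isProbabilityMeasure_expMeasure one_pos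
  have : IsFiniteMeasure (μ.withDensity fun z => (f z : ℝ≥0∞)) :=
    isFiniteMeasure_withDensity (by simp [hf1])
  have hht := measurable_height hf
  let κ := configKernel (intensity μ)
  let Φ : Measure (S × ℝ) × (S × ℝ) → ℝ≥0∞ :=
    Set.indicator {q | q.2 ∈ candidates f (κ q.1)} fun q =>
      F ((q.2.1, height f q.2), residual f (height f q.2) (κ q.1))
  have hΦ : Measurable Φ := by
    have h1 : Measurable fun q : Measure (S × ℝ) × (S × ℝ) =>
        residual f (height f q.2) (κ q.1) :=
      measurable_config_residual (F := fun _ => f) (h := Prod.fst)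
        (t := fun q : Measure (S × ℝ) × (S × ℝ) => height f q.2)
        (measurable_uncurry_const hf) measurable_fst (hht.comp measurable_snd)
    have h2 : MeasurableSet {q : Measure (S × ℝ) × (S × ℝ) | q.2 ∈ candidates f (κ q.1)} :=
      measurableSet_config_candidates (F := fun _ => f) (h := id)
        (measurable_uncurry_const hf) measurable_id
    have h3 : Measurable fun q : Measure (S × ℝ) × (S × ℝ) => height f q.2 :=
      hht.comp measurable_snd
    exact Measurable.indicator (hF.comp ((measurable_snd.fst.prodMk h3).prodMk h1)) h2
  have e1 : ∫⁻ m, ∫⁻ p in candidates f m, F ((p.1, height f p), residual f (height f p) m) ∂m ∂Q =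
      ∫⁻ m, ∫⁻ p, Φ (m, p) ∂(κ m) ∂Q := by
    refine lintegral_congr_ae ?_
    filter_upwards [h.ae_isConfig] with m hm
    have hκ : κ m = m := configKernel_apply hm
    rw [← lintegral_indicator (measurableSet_candidates hf hm), hκ]
    refine lintegral_congr fun p => ?_
    by_cases hp : p ∈ candidates f m
    · rw [Set.indicator_of_mem hp]
      simp only [Φ]
      rw [Set.indicator_of_mem (by simpa only [Set.mem_ofPred_eq, hκ] using hp), hκ]
    · rw [Set.indicator_of_notMem hp]
      simp only [Φ]
      rw [Set.indicator_of_notMem (by simpa only [Set.mem_ofPred_eq, hκ] using hp)]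
  -- By Mecke's formula the points become an added point `p`. It is a candidate when the original
  -- process is void up to the graph through `p`, an event of probability `exp (-height)`.
  -- `lintegral_map_restrict` decouples this event from the residual above the graph.
  rw [e1, h.mecke hΦ]
  have e2 : ∀ p : S × ℝ, 0 < p.2 → ∫⁻ m, Φ (m + Measure.dirac p, p) ∂Q =
      Set.indicator {p : S × ℝ | 0 < f p.1} (fun p =>
        ENNReal.ofReal (Real.exp (-(height f p))) * ∫⁻ m, F ((p.1, height f p), m) ∂Q) p := by
    intro p hp2
    by_cases hp : 0 < f p.1
    · rw [Set.indicator_of_mem (by exact hp)]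
      have hh : 0 ≤ height f p := div_nonneg hp2.le (f p.1).2
      have hR := measurableSet_region hf (height f p)
      have key := h.lintegral_map_restrict hR (by rw [intensity_region hf hf1 hh]; simp)
        hR.compl disjoint_compl_right (measurable_lower hf (height f p))
        (map_lower_intensity hf hh)
        (F := fun m => F ((p.1, height f p), m)) (hF.comp measurable_prodMk_left)
      rw [intensity_region hf hf1 hh, ENNReal.toReal_ofReal hh] at key
      have h0 : MeasurableSet {m : Measure (S × ℝ) | m (region f (height f p)) = 0} :=
        Measure.measurable_coe hR (measurableSet_singleton 0)
      rw [← key, ← lintegral_indicator h0]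
      refine lintegral_congr_ae ?_
      filter_upwards [h.ae_isConfig] with m hm
      have hκ : κ (m + Measure.dirac p) = m + Measure.dirac p :=
        configKernel_apply (hm.add_dirac p)
      have hiff := mem_candidates_add_dirac hf (m := m) hp hp2
      by_cases hm0 : m (region f (height f p)) = 0
      · rw [Set.indicator_of_mem (by exact hm0)]
        simp only [Φ]
        rw [Set.indicator_of_mem (by simpa only [Set.mem_ofPred_eq, hκ] using hiff.2 hm0), hκ,
          residual_add_dirac hf hp]
        rfl
      · rw [Set.indicator_of_notMem (by exact hm0)]
        simp only [Φ]
        rw [Set.indicator_of_notMem]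
        simpa only [Set.mem_ofPred_eq, hκ] using fun h => hm0 (hiff.1 h)
    · rw [Set.indicator_of_notMem (by exact hp), lintegral_eq_zero_iff]
      · refine Filter.Eventually.of_forall fun m => ?_
        exact Set.indicator_of_notMem (fun hq => hp hq.1) _
      · exact hΦ.comp ((measurable_id.add_const _).prodMk measurable_const)
  have hQ : Measurable fun w : S × ℝ => ∫⁻ m, F (w, m) ∂Q := hF.lintegral_prod_right'
  have hpos : MeasurableSet {p : S × ℝ | 0 < f p.1} :=
    measurableSet_lt measurable_const (hf.comp measurable_fst)
  have e3 : ∫⁻ p, ∫⁻ m, Φ (m + Measure.dirac p, p) ∂Q ∂(intensity μ) =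
      ∫⁻ p, Set.indicator {p : S × ℝ | 0 < f p.1} (fun p =>
        ENNReal.ofReal (Real.exp (-(height f p))) * ∫⁻ m, F ((p.1, height f p), m) ∂Q) p
        ∂μ.prod (volume.restrict (Set.Ioi 0)) := by
    rw [intensity, ← restrict_Ioi_eq_restrict_Ici]
    refine lintegral_congr_ae ?_
    have : ∀ᵐ p ∂μ.prod (volume.restrict (Set.Ioi (0 : ℝ))), p.2 ∈ Set.Ioi (0 : ℝ) :=
      Measure.quasiMeasurePreserving_snd.ae (ae_restrict_mem measurableSet_Ioi)
    filter_upwards [this] with p hp using e2 p hp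
  have hG : Measurable fun p : S × ℝ =>
      ENNReal.ofReal (Real.exp (-(height f p))) * ∫⁻ m, F ((p.1, height f p), m) ∂Q :=
    (by fun_prop : Measurable fun p : S × ℝ => ENNReal.ofReal (Real.exp (-(height f p)))).mul
      (hQ.comp (measurable_fst.prodMk hht))
  rw [e3, MeasureTheory.lintegral_prod _ (hG.indicator hpos).aemeasurable,
    MeasureTheory.lintegral_prod _ hF.aemeasurable,
    MeasureTheory.lintegral_prod _ hQ.aemeasurable, lintegral_withDensity_eq_lintegral_mul _ (by fun_prop)
      (hQ.lintegral_prod_right' (ν := expMeasure 1))]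
  refine lintegral_congr fun z => ?_
  rw [Pi.mul_apply]
  -- On the fibre over `z`, the substitution `v = f(z) t` produces the density `f(z)` of the
  -- location and an exponential `t`. Both sides vanish where `f z = 0`.
  by_cases hz : 0 < f z
  · rw [← lintegral_exp_div hz (F := fun t => ∫⁻ m, F ((z, t), m) ∂Q)
      (hQ.comp measurable_prodMk_left)]
    refine lintegral_congr fun v => ?_
    rw [Set.indicator_of_mem (by exact hz)]
    rfl
  · have : f z = 0 := le_antisymm (not_lt.1 hz) zero_le
    simp [Set.indicator, this]

end FirstPoint

/-! ### The first point as a single atom -/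

section Atom

variable {E : Type*} [MeasurableSpace E]

/-- With a measurable embedding `e` into `ℝ`, the integral of `exp ∘ e` against a Dirac mass at `x`
is `exp (e x)`, from which a measurable left inverse of `e` recovers `x`. The exponential makes the
integrand nonnegative. -/
lemma exists_atom (E : Type*) [MeasurableSpace E] [StandardBorelSpace E] [Nonempty E] :
    ∃ a : Measure E → E, Measurable a ∧ ∀ x, a (Measure.dirac x) = x := by
  obtain ⟨e, he⟩ := exists_measurableEmbedding_real E
  obtain ⟨r, hr, hre⟩ := he.exists_measurable_extend measurable_id fun _ => ‹Nonempty E›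
  refine ⟨fun m => r (Real.log (∫⁻ x, ENNReal.ofReal (Real.exp (e x)) ∂m).toReal), ?_, ?_⟩
  · have hm : Measurable fun x => ENNReal.ofReal (Real.exp (e x)) :=
      (Real.measurable_exp.comp he.measurable).ennreal_ofReal
    exact hr.comp (Real.measurable_log.comp (Measure.measurable_lintegral hm).ennreal_toReal)
  · intro x
    have hm : Measurable fun x => ENNReal.ofReal (Real.exp (e x)) :=
      (Real.measurable_exp.comp he.measurable).ennreal_ofReal
    simp only
    rw [lintegral_dirac' _ hm, ENNReal.toReal_ofReal (Real.exp_pos _).le, Real.log_exp]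
    exact congrFun hre x

/-- A measurable map that recovers the atom of a Dirac mass. -/
noncomputable def atom [StandardBorelSpace E] [Nonempty E] : Measure E → E :=
  (exists_atom E).choose

lemma measurable_atom [StandardBorelSpace E] [Nonempty E] :
    Measurable (atom : Measure E → E) :=
  (exists_atom E).choose_spec.1

lemma atom_dirac [StandardBorelSpace E] [Nonempty E] (x : E) : atom (Measure.dirac x) = x :=
  (exists_atom E).choose_spec.2 x

lemma eq_dirac_of_measure_compl_singleton [MeasurableSingletonClass E] {m : Measure E}
    (hm : m Set.univ = 1) {x : E} (hx : m {x}ᶜ = 0) : m = Measure.dirac x := by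
  have hx1 : m {x} = 1 := by
    rw [← hm, ← measure_add_measure_compl (measurableSet_singleton x), hx, add_zero]
  ext s hs
  rw [Measure.dirac_apply' x hs]
  by_cases h : x ∈ s
  · rw [Set.indicator_of_mem h, Pi.one_apply]
    refine le_antisymm (hm ▸ measure_mono (Set.subset_univ s)) ?_
    exact hx1 ▸ measure_mono (Set.singleton_subset_iff.2 h)
  · rw [Set.indicator_of_notMem h]
    exact measure_mono_null (fun y hy (h' : y = x) => h (h' ▸ hy)) hx

end Atom

section FirstPoint

variable {S : Type*} [MeasurableSpace S] {μ : Measure S} [SigmaFinite μ] {f : S → ℝ≥0}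
  {Q : Measure (Measure (S × ℝ))}

/-- The mass of the candidates is at most one and, by `lintegral_candidates` with constant
integrand, has mean one. -/
lemma IsPoissonLaw.ae_measure_candidates (h : IsPoissonLaw (intensity μ) Q) (hf : Measurable f)
    (hf1 : ∫⁻ z, f z ∂μ = 1) : ∀ᵐ m ∂Q, m (candidates f m) = 1 := by
  have := h.isProbabilityMeasure
  have := isProbabilityMeasure_expMeasure one_pos
  have : IsProbabilityMeasure (μ.withDensity fun z => (f z : ℝ≥0∞)) := ⟨by simp [hf1]⟩
  have h1 := h.lintegral_candidates hf hf1 (F := fun _ => 1) measurable_const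
  simp only [lintegral_const, measure_univ, mul_one, Measure.restrict_apply MeasurableSet.univ,
    Set.univ_inter, one_mul] at h1
  refine ae_eq_of_ae_le_of_lintegral_le (g := fun _ => 1)
    (Filter.Eventually.of_forall fun m => measure_candidates_le f m) (by simp [h1])
    aemeasurable_const (by simp [h1])

/-- For another candidate `q`, either `p` lies under the graph through `q` and uses up the unit of
mass there, or `q` is at most as high as `p`, where `m` has no mass. In both cases `q` belongs to a
nested union of `m`-null regions. -/
lemma measure_candidates_add_dirac_diff [MeasurableSingletonClass S] (hf : Measurable f)
    {m : Measure (S × ℝ)} {p : S × ℝ} (hp : p ∈ candidates f (m + Measure.dirac p)) :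
    (m + Measure.dirac p) (candidates f (m + Measure.dirac p) \ {p}) = 0 := by
  have hm0 := (mem_candidates_add_dirac hf hp.1 hp.2.1).1 hp
  have hsub : candidates f (m + Measure.dirac p) \ {p} ⊆
      ⋃ t ∈ {t | m (region f t) = 0}, region f t := by
    rintro q ⟨hq, -⟩
    refine Set.mem_biUnion (x := height f q) ?_ ((mem_region_height hq.1).2 le_rfl)
    have h1 := hq.2.2
    rw [Measure.add_apply, Measure.dirac_apply' _ (measurableSet_region hf _)] at h1
    by_cases hpq : p ∈ region f (height f q)
    · rw [Set.indicator_of_mem hpq, Pi.one_apply] at h1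
      by_contra h0
      have := ENNReal.lt_add_right (a := 1) (by simp) h0
      rw [add_comm, h1] at this
      exact this.false
    · have hlt : height f q ≤ height f p := le_of_not_ge fun h => hpq ((mem_region_height hp.1).2 h)
      exact measure_mono_null (region_mono f hlt) hm0
  rw [Measure.add_apply]
  have e1 : m (candidates f (m + Measure.dirac p) \ {p}) = 0 :=
    measure_mono_null hsub (nonpos_iff_eq_zero.1 (measure_biUnion_region_le fun t ht => le_of_eq ht))
  have e2 : Measure.dirac p (candidates f (m + Measure.dirac p) \ {p}) = 0 :=
    measure_mono_null (fun x hx => hx.2) (by simp : Measure.dirac p {p}ᶜ = 0)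
  rw [e1, e2, add_zero]

/-- Mass one on the candidates does not by itself make a Dirac mass. Mecke's formula, applied to the
mass of the candidates other than `p`, shows that almost every candidate carries all of it. -/
lemma IsPoissonLaw.ae_exists_candidates_eq_dirac [StandardBorelSpace S]
    (h : IsPoissonLaw (intensity μ) Q) (hf : Measurable f) (hf1 : ∫⁻ z, f z ∂μ = 1) :
    ∀ᵐ m ∂Q, ∃ p ∈ candidates f m, m.restrict (candidates f m) = Measure.dirac p := by
  have := h.isProbabilityMeasure
  let κ := configKernel (intensity μ)
  have hsq : MeasurableSet {q : Measure (S × ℝ) × (S × ℝ) | q.2 ∈ candidates f (κ q.1)} :=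
    measurableSet_config_candidates (F := fun _ => f) (h := id)
      (measurable_uncurry_const hf) measurable_id
  let Φ : Measure (S × ℝ) × (S × ℝ) → ℝ≥0∞ :=
    Set.indicator {q | q.2 ∈ candidates f (κ q.1)} fun q =>
      κ q.1 (candidates f (κ q.1) \ {q.2})
  have hΦ : Measurable Φ := by
    refine Measurable.indicator ?_ hsq
    refine measurable_config_apply (α := Measure (S × ℝ) × (S × ℝ)) (h := Prod.fst) measurable_fst
      (D := fun q => candidates f (κ q.1) \ {q.2}) ?_
    refine MeasurableSet.inter ?_ ?_
    · exact (measurable_fst.fst.prodMk measurable_snd :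
        Measurable fun q : (Measure (S × ℝ) × (S × ℝ)) × (S × ℝ) => (q.1.1, q.2)) hsq
    · exact (measurableSet_eq_fun measurable_snd measurable_fst.snd :
        MeasurableSet {q : (Measure (S × ℝ) × (S × ℝ)) × (S × ℝ) | q.2 = q.1.2}).compl
  have hzero : ∫⁻ m, ∫⁻ p, Φ (m, p) ∂(κ m) ∂Q = 0 := by
    rw [h.mecke hΦ]
    have : ∀ p, ∫⁻ m, Φ (m + Measure.dirac p, p) ∂Q = 0 := by
      intro p
      have hΦp : Measurable fun m => Φ (m + Measure.dirac p, p) :=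
        hΦ.comp ((measurable_id.add_const _).prodMk measurable_const)
      rw [lintegral_eq_zero_iff hΦp]
      filter_upwards [h.ae_isConfig] with m hm
      have hκ : κ (m + Measure.dirac p) = m + Measure.dirac p :=
        configKernel_apply (hm.add_dirac p)
      simp only [Φ, Pi.zero_apply]
      refine Set.indicator_apply_eq_zero.2 fun hp => ?_
      simp only [Set.mem_ofPred_eq, hκ] at hp ⊢
      exact measure_candidates_add_dirac_diff hf hp
    simp [this]
  rw [lintegral_eq_zero_iff (by exact Measurable.lintegral_kernel_prod_right' hΦ)] at hzero
  filter_upwards [h.ae_measure_candidates hf hf1, h.ae_isConfig, hzero] with m hm1 hm h0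
  have hκ : κ m = m := configKernel_apply hm
  have hmeas := measurableSet_candidates hf hm
  have hΦm : Measurable fun p => Φ (m, p) := hΦ.comp measurable_prodMk_left
  rw [Pi.zero_apply, hκ, lintegral_eq_zero_iff hΦm] at h0
  have hex : ∃ p ∈ candidates f m, m (candidates f m \ {p}) = 0 := by
    by_contra hne
    push Not at hne
    have : ∀ᵐ p ∂m, p ∉ candidates f m := by
      filter_upwards [h0] with p hp hpc
      have := Set.indicator_apply_eq_zero.1 hp (by simpa only [Set.mem_ofPred_eq, hκ] using hpc)
      simp only [hκ] at this
      exact hne p hpc this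
    have h2 : m (candidates f m) = 0 := by
      rw [ae_iff] at this
      simpa using this
    rw [h2] at hm1
    exact zero_ne_one hm1
  obtain ⟨p, hp, hp0⟩ := hex
  refine ⟨p, hp, eq_dirac_of_measure_compl_singleton (by simpa using hm1) ?_⟩
  rw [Measure.restrict_apply (measurableSet_singleton p).compl, Set.inter_comm]
  exact hp0

end FirstPoint

/-! ### The exploration step and its inverse -/

section Unstep

variable {S : Type*} [MeasurableSpace S] (μ : Measure S) [SigmaFinite μ]

/-- Insert a point on the graph `t f` below the configuration `m`. -/
noncomputable def unstep (f : S → ℝ≥0) (w : S × ℝ) (m : Measure (S × ℝ)) : Measure (S × ℝ) :=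
  (configKernel (intensity μ) m).map (raise f w.2) + Measure.dirac (w.1, w.2 * f w.1)

variable {μ}

lemma measurable_unstep {α : Type*} [MeasurableSpace α] {F : α → S → ℝ≥0}
    {h : α → Measure (S × ℝ)} {w : α → S × ℝ} (hF : Measurable (Function.uncurry F))
    (hh : Measurable h) (hw : Measurable w) :
    Measurable fun a => unstep μ (F a) (w a) (h a) := by
  have h1 := measurable_config_map_raise (μ := μ) hF hh hw.snd
  have h2 : Measurable fun a => ((w a).2 * F a (w a).1 : ℝ) :=
    hw.snd.mul (hF.comp (measurable_id.prodMk hw.fst)).coe_nnreal_real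
  have := measurable_add_dirac.comp (h1.prodMk (hw.fst.prodMk h2))
  exact this

end Unstep

section Step

variable {S : Type*} [MeasurableSpace S] [StandardBorelSpace S] [Nonempty S]
  (μ : Measure S) [SigmaFinite μ]

/-- The first point of the configuration `m` met by the graphs `t f` as `t` increases. -/
noncomputable def firstPoint (f : S → ℝ≥0) (m : Measure (S × ℝ)) : S × ℝ :=
  atom ((configKernel (intensity μ) m).restrict (candidates f (configKernel (intensity μ) m)))

/-- One step of the exploration of the configuration `m`: the location of the first point met by the
graphs `t f`, the corresponding `t`, and the remaining configuration above `t f`. -/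
noncomputable def step (f : S → ℝ≥0) (m : Measure (S × ℝ)) : (S × ℝ) × Measure (S × ℝ) :=
  (((firstPoint μ f m).1, height f (firstPoint μ f m)),
    residual f (height f (firstPoint μ f m)) (configKernel (intensity μ) m))

variable {μ} {f : S → ℝ≥0} {Q : Measure (Measure (S × ℝ))}

lemma measurable_step {α : Type*} [MeasurableSpace α] {F : α → S → ℝ≥0}
    {h : α → Measure (S × ℝ)} (hF : Measurable (Function.uncurry F)) (hh : Measurable h) :
    Measurable fun a => step μ (F a) (h a) := by
  have h1 : Measurable fun a => firstPoint μ (F a) (h a) :=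
    measurable_atom.comp (measurable_config_restrict_candidates hF hh)
  have h2 : Measurable fun a => F a (firstPoint μ (F a) (h a)).1 :=
    hF.comp (measurable_id.prodMk h1.fst)
  have h3 : Measurable fun a => height (F a) (firstPoint μ (F a) (h a)) := by
    unfold height
    exact h1.snd.div h2.coe_nnreal_real
  exact (h1.fst.prodMk h3).prodMk (measurable_config_residual hF hh h3)

/-- Almost surely the candidates reduce to a single Dirac mass, so the integral over candidates in
`lintegral_candidates` is the value at the first point. -/
theorem IsPoissonLaw.map_step (h : IsPoissonLaw (intensity μ) Q) (hf : Measurable f)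
    (hf1 : ∫⁻ z, f z ∂μ = 1) :
    Q.map (step μ f) = ((μ.withDensity fun z => f z).prod (expMeasure 1)).prod Q := by
  have hm : Measurable (step μ f) :=
    measurable_step (F := fun _ => f) (measurable_uncurry_const hf) measurable_id
  refine Measure.ext_of_lintegral _ fun F hF => ?_
  rw [lintegral_map hF hm, ← h.lintegral_candidates hf hf1 hF]
  refine lintegral_congr_ae ?_
  filter_upwards [h.ae_isConfig, h.ae_exists_candidates_eq_dirac hf hf1] with m hm ⟨p, hp, hd⟩
  have hκ : configKernel (intensity μ) m = m := configKernel_apply hm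
  have hfp : firstPoint μ f m = p := by rw [firstPoint, hκ, hd, atom_dirac]
  rw [hd, lintegral_dirac, step, hfp, hκ]

/-- Above the graph, raising undoes lowering. On or below it, the configuration has mass one, all of
it at the first point, which `unstep` puts back. -/
theorem IsPoissonLaw.ae_unstep_step (h : IsPoissonLaw (intensity μ) Q) (hf : Measurable f)
    (hf1 : ∫⁻ z, f z ∂μ = 1) :
    ∀ᵐ m ∂Q, unstep μ f (step μ f m).1 (step μ f m).2 = m ∧ 0 < (step μ f m).1.2 := by
  have := h.isProbabilityMeasure
  have := isProbabilityMeasure_expMeasure one_pos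
  have : IsProbabilityMeasure (μ.withDensity fun z => (f z : ℝ≥0∞)) := ⟨by simp [hf1]⟩
  have hmeas : Measurable (step μ f) :=
    measurable_step (F := fun _ => f) (measurable_uncurry_const hf) measurable_id
  -- `unstep` reads its argument through `configKernel`, so the residual must be finite on cells.
  -- This holds because its law is `Q` again.
  have hres : ∀ᵐ m ∂Q, IsConfig (intensity μ) (step μ f m).2 := by
    refine ae_of_ae_map (f := fun m => (step μ f m).2) hmeas.snd.aemeasurable ?_
    have : Q.map (fun m => (step μ f m).2) = Q := by
      have h2 := Measure.map_map (μ := Q) measurable_snd hmeas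
      rw [h.map_step hf hf1, Measure.map_snd_prod, measure_univ, one_smul] at h2
      exact h2.symm
    rw [this]
    exact h.ae_isConfig
  filter_upwards [h.ae_isConfig, h.ae_exists_candidates_eq_dirac hf hf1, hres]
    with m hm ⟨p, hp, hd⟩ hr
  have hκ : configKernel (intensity μ) m = m := configKernel_apply hm
  have hfp : firstPoint μ f m = p := by rw [firstPoint, hκ, hd, atom_dirac]
  have hs : step μ f m = ((p.1, height f p), residual f (height f p) m) := by
    rw [step, hfp, hκ]
  have hfpos : (0 : ℝ) < f p.1 := hp.1
  rw [hs] at hr ⊢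
  refine ⟨?_, div_pos hp.2.1 hfpos⟩
  simp only at hr
  have hR := measurableSet_region hf (height f p)
  have hpp : (p.1, height f p * f p.1) = p := by
    ext
    · rfl
    · exact div_mul_cancel₀ _ hfpos.ne'
  have hraise : (residual f (height f p) m).map (raise f (height f p)) =
      m.restrict (region f (height f p))ᶜ := by
    rw [residual, Measure.map_map (measurable_raise hf _) (measurable_lower hf _)]
    convert Measure.map_id
    ext q <;> simp [raise, lower]
  have hdir : m.restrict (region f (height f p)) = Measure.dirac p := by
    have h1 : m (region f (height f p)) = 1 := hp.2.2
    have hp1 : 1 ≤ m {p} := by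
      have : m.restrict (candidates f m) {p} = 1 := by rw [hd]; simp
      rw [← this]
      exact Measure.restrict_apply_le _ _
    have hpR : p ∈ region f (height f p) := (mem_region_height hp.1).2 le_rfl
    refine eq_dirac_of_measure_compl_singleton (by simpa using h1) ?_
    rw [Measure.restrict_apply (measurableSet_singleton p).compl, Set.inter_comm,
      ← Set.sdiff_eq, measure_sdiff (Set.singleton_subset_iff.2 hpR)
        (measurableSet_singleton p).nullMeasurableSet]
    · rw [h1]; exact tsub_eq_zero_of_le hp1
    · exact ((measure_mono (Set.singleton_subset_iff.2 hpR)).trans_lt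
        (h1 ▸ ENNReal.one_lt_top)).ne
  simp only [unstep]
  rw [configKernel_apply hr, hraise, hpp, ← hdir, add_comm,
    Measure.restrict_add_restrict_compl hR]

/-- Inserting a point with law `f μ` at an exponential multiple of `f` below an independent Poisson
process gives again the Poisson process. -/
theorem IsPoissonLaw.map_unstep (h : IsPoissonLaw (intensity μ) Q) (hf : Measurable f)
    (hf1 : ∫⁻ z, f z ∂μ = 1) :
    (((μ.withDensity fun z => f z).prod (expMeasure 1)).prod Q).map
      (fun q => unstep μ f q.1 q.2) = Q := by
  have hu : Measurable fun q : (S × ℝ) × Measure (S × ℝ) => unstep μ f q.1 q.2 :=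
    measurable_unstep (F := fun _ => f) (measurable_uncurry_const hf) measurable_snd measurable_fst
  have hs : Measurable (step μ f) :=
    measurable_step (F := fun _ => f) (measurable_uncurry_const hf) measurable_id
  rw [← h.map_step hf hf1, Measure.map_map hu hs]
  conv_rhs => rw [← Measure.map_id (μ := Q)]
  refine Measure.map_congr ?_
  filter_upwards [h.ae_unstep_step hf hf1] with m hm using hm.1

end Step

/-! ### Generated σ-algebras and conditional laws -/

section SigmaAlgebras

variable {Ω : Type*}

lemma isPiSystem_inter_measurableSet (m m' : MeasurableSpace Ω) :
    IsPiSystem {s | ∃ A A', MeasurableSet[m] A ∧ MeasurableSet[m'] A' ∧ s = A ∩ A'} := by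
  rintro _ ⟨A, A', hA, hA', rfl⟩ _ ⟨B, B', hB, hB', rfl⟩ -
  exact ⟨A ∩ B, A' ∩ B', hA.inter hB, hA'.inter hB', Set.inter_inter_inter_comm _ _ _ _⟩

lemma sup_eq_generateFrom_inter (m m' : MeasurableSpace Ω) :
    m ⊔ m' = MeasurableSpace.generateFrom
      {s | ∃ A A', MeasurableSet[m] A ∧ MeasurableSet[m'] A' ∧ s = A ∩ A'} := by
  refine le_antisymm (sup_le ?_ ?_) (MeasurableSpace.generateFrom_le ?_)
  · exact fun A hA => MeasurableSpace.measurableSet_generateFrom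
      ⟨A, Set.univ, hA, MeasurableSet.univ, (Set.inter_univ A).symm⟩
  · exact fun A hA => MeasurableSpace.measurableSet_generateFrom
      ⟨Set.univ, A, MeasurableSet.univ, hA, (Set.univ_inter A).symm⟩
  · rintro _ ⟨A, A', hA, hA', rfl⟩
    exact MeasurableSet.inter (le_sup_left (a := m) (b := m') A hA)
      (le_sup_right (a := m) (b := m') A' hA')

lemma indep_sup_of_inter {m₁ m₁' m₂ m₂' mΩ : MeasurableSpace Ω} {P : Measure Ω}
    [IsProbabilityMeasure P] (h₁ : m₁ ≤ mΩ) (h₁' : m₁' ≤ mΩ) (h₂ : m₂ ≤ mΩ) (h₂' : m₂' ≤ mΩ)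
    (h : ∀ A A' B B', MeasurableSet[m₁] A → MeasurableSet[m₁'] A' → MeasurableSet[m₂] B →
      MeasurableSet[m₂'] B' → P ((A ∩ A') ∩ (B ∩ B')) = P (A ∩ A') * P (B ∩ B')) :
    Indep (m₁ ⊔ m₁') (m₂ ⊔ m₂') P := by
  refine IndepSets.indep (sup_le h₁ h₁') (sup_le h₂ h₂') (isPiSystem_inter_measurableSet _ _)
    (isPiSystem_inter_measurableSet _ _) (sup_eq_generateFrom_inter _ _)
    (sup_eq_generateFrom_inter _ _) ((IndepSets_iff _ _ _).2 ?_)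
  rintro _ _ ⟨A, A', hA, hA', rfl⟩ ⟨B, B', hB, hB', rfl⟩
  exact h A A' B B' hA hA' hB hB'

lemma indep_sup_left_of_inter {m₁ m₁' m₂ mΩ : MeasurableSpace Ω} {P : Measure Ω}
    [IsProbabilityMeasure P] (h₁ : m₁ ≤ mΩ) (h₁' : m₁' ≤ mΩ) (h₂ : m₂ ≤ mΩ)
    (h : ∀ A A' B, MeasurableSet[m₁] A → MeasurableSet[m₁'] A' → MeasurableSet[m₂] B →
      P ((A ∩ A') ∩ B) = P (A ∩ A') * P B) :
    Indep (m₁ ⊔ m₁') m₂ P := by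
  have := indep_sup_of_inter (P := P) (m₂' := ⊥) h₁ h₁' h₂ bot_le
    fun A A' B B' hA hA' hB hB' => by
      rcases MeasurableSpace.measurableSet_bot_iff.1 hB' with rfl | rfl
      · simp
      · rw [Set.inter_univ]; exact h A A' B hA hA' hB
  simpa using this

/-- The σ-algebra generated by `W 0, …, W n`. -/
abbrev hist {β : Type*} [MeasurableSpace β] (W : ℕ → Ω → β) (n : ℕ) : MeasurableSpace Ω :=
  ⨆ j ≤ n, MeasurableSpace.comap (W j) inferInstance

variable {β : Type*} [MeasurableSpace β] {W : ℕ → Ω → β}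

lemma hist_zero : hist W 0 = MeasurableSpace.comap (W 0) inferInstance := by
  simp [hist]

lemma hist_succ (n : ℕ) :
    hist W (n + 1) = hist W n ⊔ MeasurableSpace.comap (W (n + 1)) inferInstance := by
  refine le_antisymm (iSup₂_le fun j hj => ?_) (sup_le ?_ ?_)
  · rcases Nat.le_succ_iff.1 hj with h | rfl
    · exact le_sup_of_le_left
        (le_iSup₂ (f := fun j (_ : j ≤ n) => MeasurableSpace.comap (W j) inferInstance) j h)
    · exact le_sup_right
  · exact iSup₂_le fun j hj => le_iSup₂
      (f := fun j (_ : j ≤ n + 1) => MeasurableSpace.comap (W j) inferInstance) j (by omega)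
  · exact le_iSup₂
      (f := fun j (_ : j ≤ n + 1) => MeasurableSpace.comap (W j) inferInstance) (n + 1) le_rfl

lemma comap_le_hist {j n : ℕ} (h : j ≤ n) :
    MeasurableSpace.comap (W j) inferInstance ≤ hist W n :=
  le_iSup₂ (f := fun j (_ : j ≤ n) => MeasurableSpace.comap (W j) inferInstance) j h

lemma measurable_hist {j n : ℕ} (h : j ≤ n) : Measurable[hist W n] (W j) :=
  measurable_iff_comap_le.2 (comap_le_hist h)

lemma monotone_hist : Monotone (hist W) := fun _ _ h =>
  iSup₂_le fun _ hj => comap_le_hist (hj.trans h)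

lemma hist_le [mΩ : MeasurableSpace Ω] (hW : ∀ j, Measurable (W j)) (n : ℕ) : hist W n ≤ mΩ :=
  iSup₂_le fun j _ => measurable_iff_comap_le.1 (hW j)

lemma hist_comp_le {γ : Type*} [MeasurableSpace γ] {φ : β → γ} (hφ : Measurable φ) (n : ℕ) :
    hist (fun j ω => φ (W j ω)) n ≤ hist W n :=
  iSup₂_le fun _ hj => measurable_iff_comap_le.1 (hφ.comp (measurable_hist hj))

lemma comap_pi_eq_iSup {ι : Type*} (X : ι → Ω → β) :
    MeasurableSpace.comap (fun ω i => X i ω) inferInstance =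
      ⨆ i, MeasurableSpace.comap (X i) inferInstance := by
  simp only [MeasurableSpace.pi, MeasurableSpace.comap_iSup, MeasurableSpace.comap_comp]
  rfl

end SigmaAlgebras

section CondLaw

variable {Ω α β : Type*} {𝓕 mΩ : MeasurableSpace Ω} [MeasurableSpace α] [MeasurableSpace β]
  {P : Measure Ω} {X : Ω → α}

/-- If `Y` is independent of `𝓕` and `X` is `𝓕`-measurable, then conditionally on `𝓕` one can
integrate out `Y`. -/
lemma setLIntegral_of_indep [IsProbabilityMeasure P] (h𝓕 : 𝓕 ≤ mΩ) (hX : Measurable[𝓕] X)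
    {Y : Ω → β} (hY : Measurable Y) (hi : Indep 𝓕 (MeasurableSpace.comap Y inferInstance) P)
    {B : Set Ω} (hB : MeasurableSet[𝓕] B) {F : α × β → ℝ≥0∞} (hF : Measurable F) :
    ∫⁻ ω in B, F (X ω, Y ω) ∂P = ∫⁻ ω in B, ∫⁻ y, F (X ω, y) ∂(P.map Y) ∂P := by
  have hX' : Measurable X := hX.mono h𝓕 le_rfl
  have := Measure.isProbabilityMeasure_map (μ := P) hY.aemeasurable
  have key : (P.restrict B).map (fun ω => (X ω, Y ω)) =
      ((P.restrict B).map X).prod (P.map Y) := by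
    refine Measure.ext_prod fun {s t} hs ht => ?_
    rw [Measure.prod_prod, Measure.map_apply (hX'.prodMk hY) (hs.prod ht),
      Measure.map_apply hX' hs, Measure.map_apply hY ht,
      Measure.restrict_apply ((hX'.prodMk hY) (hs.prod ht)), Measure.restrict_apply (hX' hs)]
    have := (Indep_iff _ _ _).1 hi (X ⁻¹' s ∩ B) (Y ⁻¹' t) ((hX hs).inter hB) ⟨t, ht, rfl⟩
    rw [← this]
    congr 1
    ext ω
    simp only [Set.mem_inter_iff, Set.mem_preimage, Set.mem_prod]
    tauto
  rw [← lintegral_map hF (hX'.prodMk hY), key, lintegral_prod _ hF.aemeasurable,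
    lintegral_map hF.lintegral_prod_right' hX']

/-- Conditionally on `𝓕`, the law of `W` is `K (X ω)`. -/
def CondLaw (P : Measure Ω) (𝓕 : MeasurableSpace Ω) (W : Ω → β) (X : Ω → α) (K : Kernel α β) :
    Prop :=
  ∀ B, MeasurableSet[𝓕] B → ∀ D, MeasurableSet D → P (B ∩ W ⁻¹' D) = ∫⁻ ω in B, K (X ω) D ∂P

variable {W : Ω → β} {K : Kernel α β}

lemma CondLaw.setLIntegral [IsProbabilityMeasure P] [IsMarkovKernel K] (h : CondLaw P 𝓕 W X K)
    (h𝓕 : 𝓕 ≤ mΩ) (hX : Measurable[𝓕] X) (hW : Measurable W)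
    {B : Set Ω} (hB : MeasurableSet[𝓕] B) {F : α × β → ℝ≥0∞} (hF : Measurable F) :
    ∫⁻ ω in B, F (X ω, W ω) ∂P = ∫⁻ ω in B, ∫⁻ w, F (X ω, w) ∂(K (X ω)) ∂P := by
  have hX' : Measurable X := hX.mono h𝓕 le_rfl
  have key : (P.restrict B).map (fun ω => (X ω, W ω)) = ((P.restrict B).map X) ⊗ₘ K := by
    refine Measure.ext_prod fun {s t} hs ht => ?_
    rw [Measure.compProd_apply_prod hs ht, Measure.map_apply (hX'.prodMk hW) (hs.prod ht),
      setLIntegral_map hs (K.measurable_coe ht) hX',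
      Measure.restrict_apply ((hX'.prodMk hW) (hs.prod ht)), Measure.restrict_restrict (hX' hs),
      ← h _ ((hX hs).inter hB) t ht]
    congr 1
    ext ω
    simp only [Set.mem_inter_iff, Set.mem_preimage, Set.mem_prod]
    tauto
  rw [← lintegral_map hF (hX'.prodMk hW), key, Measure.lintegral_compProd hF,
    lintegral_map hF.lintegral_kernel_prod_right' hX']

end CondLaw

/-! ### Steps whose density depends on the past -/

section Transition

lemma IsTransitionDensity.measurable_left {S : Type*} [MeasurableSpace S] {μ : Measure S}
    {f : S → S → ℝ≥0} (hf : IsTransitionDensity μ f) (x : S) :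
    Measurable (f x) :=
  hf.measurable.comp measurable_prodMk_left

variable {S : Type*} [MeasurableSpace S] (μ : Measure S) [SigmaFinite μ]

/-- The transition kernel with density `f`. -/
noncomputable def transKernel (f : S → S → ℝ≥0) : Kernel S S :=
  Kernel.withDensity (Kernel.const S μ) fun x z => (f x z : ℝ≥0∞)

/-- The law of one step of the chain together with an independent exponential variable. -/
noncomputable def stepKernel (f : S → S → ℝ≥0) : Kernel S (S × ℝ) :=
  transKernel μ f ×ₖ Kernel.const S (expMeasure 1)

instance : IsProbabilityMeasure (expMeasure 1) := isProbabilityMeasure_expMeasure one_pos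

variable {μ} {f : S → S → ℝ≥0}

lemma transKernel_apply (hf : IsTransitionDensity μ f) (x : S) :
    transKernel μ f x = μ.withDensity fun z => f x z := by
  have : Measurable (Function.uncurry fun x z => (f x z : ℝ≥0∞)) :=
    hf.measurable.coe_nnreal_ennreal
  rw [transKernel, Kernel.withDensity_apply _ this, Kernel.const_apply]

lemma isMarkovKernel_transKernel (hf : IsTransitionDensity μ f) :
    IsMarkovKernel (transKernel μ f) :=
  ⟨fun x => ⟨by rw [transKernel_apply hf]; simpa using hf.lintegral_eq_one x⟩⟩

lemma stepKernel_apply (hf : IsTransitionDensity μ f) (x : S) :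
    stepKernel μ f x = (μ.withDensity fun z => f x z).prod (expMeasure 1) := by
  have := isMarkovKernel_transKernel hf
  rw [stepKernel, Kernel.prod_apply, transKernel_apply hf, Kernel.const_apply]

lemma isMarkovKernel_stepKernel (hf : IsTransitionDensity μ f) :
    IsMarkovKernel (stepKernel μ f) := by
  have := isMarkovKernel_transKernel hf
  unfold stepKernel
  infer_instance

lemma stepKernel_prod (hf : IsTransitionDensity μ f) (x : S) (A : Set S) (C : Set ℝ) :
    stepKernel μ f x (A ×ˢ C) = transKernel μ f x A * expMeasure 1 C := by
  have := isMarkovKernel_transKernel hf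
  rw [stepKernel_apply hf, ← transKernel_apply hf, Measure.prod_prod]

variable {Ω : Type*} {𝓕 mΩ : MeasurableSpace Ω} {P : Measure Ω} [IsProbabilityMeasure P]
  {X : Ω → S} {η : Ω → Measure (S × ℝ)} {Q : Measure (Measure (S × ℝ))}
  [StandardBorelSpace S] [Nonempty S]

lemma measurable_uncurry_step (hf : IsTransitionDensity μ f) :
    Measurable fun p : S × Measure (S × ℝ) => step μ (f p.1) p.2 := by
  have h1 : Measurable (Function.uncurry fun p : S × Measure (S × ℝ) => f p.1) :=
    hf.measurable.comp (measurable_fst.fst.prodMk measurable_snd)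
  exact measurable_step h1 measurable_snd

/-- The exploration step applied to a Poisson process independent of the past. -/
lemma measure_inter_step (hQ : IsPoissonLaw (intensity μ) Q) (hf : IsTransitionDensity μ f)
    (h𝓕 : 𝓕 ≤ mΩ) (hX : Measurable[𝓕] X) (hη : Measurable η)
    (hi : Indep 𝓕 (MeasurableSpace.comap η inferInstance) P) (hηQ : P.map η = Q)
    {B : Set Ω} (hB : MeasurableSet[𝓕] B) {D : Set ((S × ℝ) × Measure (S × ℝ))}
    (hD : MeasurableSet D) :
    P (B ∩ (fun ω => step μ (f (X ω)) (η ω)) ⁻¹' D) =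
      ∫⁻ ω in B, ((stepKernel μ f (X ω)).prod Q) D ∂P := by
  have hs := measurable_uncurry_step hf
  have hstep : Measurable fun ω => step μ (f (X ω)) (η ω) :=
    (hs.comp ((hX.mono h𝓕 le_rfl).prodMk hη) :)
  have key := setLIntegral_of_indep h𝓕 hX hη hi hB
    (F := fun p => D.indicator 1 (step μ (f p.1) p.2)) ((measurable_one.indicator hD).comp hs)
  rw [hηQ] at key
  rw [Set.inter_comm, ← Measure.restrict_apply (hstep hD), ← lintegral_indicator_one (hstep hD)]
  refine Eq.trans ?_ (key.trans ?_)
  · rfl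
  · refine lintegral_congr fun ω => ?_
    have hsx : Measurable (step μ (f (X ω))) :=
      (hs.comp (measurable_prodMk_left (x := X ω)) :)
    rw [← lintegral_map (measurable_one.indicator hD) hsx,
      hQ.map_step (hf.measurable_left _) (hf.lintegral_eq_one _), lintegral_indicator_one hD,
      stepKernel_apply hf]

lemma condLaw_step (hQ : IsPoissonLaw (intensity μ) Q) (hf : IsTransitionDensity μ f)
    (h𝓕 : 𝓕 ≤ mΩ) (hX : Measurable[𝓕] X) (hη : Measurable η)
    (hi : Indep 𝓕 (MeasurableSpace.comap η inferInstance) P) (hηQ : P.map η = Q) :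
    CondLaw P 𝓕 (fun ω => (step μ (f (X ω)) (η ω)).1) X (stepKernel μ f) := by
  intro B hB D hD
  have := hQ.isProbabilityMeasure
  have := measure_inter_step hQ hf h𝓕 hX hη hi hηQ hB (hD.prod MeasurableSet.univ)
  simp only [Measure.prod_prod, measure_univ, mul_one] at this
  rw [← this]
  congr 2
  ext ω
  simp

/-- Given the past, the new pair and the residual have joint law `stepKernel` times `Q`, and the
second factor ignores the state. The residual is thus a fresh Poisson process independent of the
enlarged past, so the step can be repeated. -/
lemma indep_step (hQ : IsPoissonLaw (intensity μ) Q) (hf : IsTransitionDensity μ f)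
    (h𝓕 : 𝓕 ≤ mΩ) (hX : Measurable[𝓕] X) (hη : Measurable η)
    (hi : Indep 𝓕 (MeasurableSpace.comap η inferInstance) P) (hηQ : P.map η = Q) :
    Indep (𝓕 ⊔ MeasurableSpace.comap (fun ω => (step μ (f (X ω)) (η ω)).1) inferInstance)
      (MeasurableSpace.comap (fun ω => (step μ (f (X ω)) (η ω)).2) inferInstance) P ∧
    P.map (fun ω => (step μ (f (X ω)) (η ω)).2) = Q := by
  have := hQ.isProbabilityMeasure
  have := isMarkovKernel_stepKernel hf
  have hs := measurable_uncurry_step hf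
  have hstep : Measurable fun ω => step μ (f (X ω)) (η ω) :=
    (hs.comp ((hX.mono h𝓕 le_rfl).prodMk hη) :)
  have hlaw : P.map (fun ω => (step μ (f (X ω)) (η ω)).2) = Q := by
    ext D hD
    rw [Measure.map_apply hstep.snd hD]
    have := measure_inter_step hQ hf h𝓕 hX hη hi hηQ (B := Set.univ) MeasurableSet.univ
      (MeasurableSet.univ.prod hD)
    simp only [Measure.prod_prod, measure_univ, one_mul, Set.univ_inter, lintegral_const,
      Measure.restrict_univ, mul_one] at this
    rw [← this]
    congr 1
    ext ω
    simp
  refine ⟨?_, hlaw⟩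
  have h1 := measurable_iff_comap_le.1 hstep.fst
  have h2 := measurable_iff_comap_le.1 hstep.snd
  refine indep_sup_left_of_inter h𝓕 h1 h2 ?_
  rintro A _ _ hA ⟨D, hD, rfl⟩ ⟨D', hD', rfl⟩
  rw [← Measure.map_apply hstep.snd hD', hlaw, condLaw_step hQ hf h𝓕 hX hη hi hηQ A hA D hD]
  have := measure_inter_step hQ hf h𝓕 hX hη hi hηQ hA (hD.prod hD')
  simp only [Measure.prod_prod] at this
  rw [lintegral_mul_const _ (by
    exact ((stepKernel μ f).measurable_coe hD).comp (hX.mono h𝓕 le_rfl))] at this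
  rw [← this, Set.inter_assoc]
  rfl

end Transition

section MeasurableEq

variable {E α : Type*} [MeasurableSpace E] [MeasurableSpace α] {ν : Measure E} [SigmaFinite ν]

lemma eq_of_forall_finiteCell {m m' : Measure E}
    (h : ∀ k, m.restrict (finiteCell ν k) = m'.restrict (finiteCell ν k)) : m = m' :=
  Measure.ext_of_iUnion_eq_univ (iUnion_finiteCell ν) h

/-- Finite measures on a standard Borel space are determined by countably many values, the preimages
of rational half-lines under an embedding into `ℝ`. Finiteness on the cells makes the comparison
possible cell by cell. -/
lemma measurableSet_eq_of_isConfig [StandardBorelSpace E] {A B : α → Measure E}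
    (hA : Measurable A) (hB : Measurable B) :
    MeasurableSet {a | IsConfig ν (A a) ∧ IsConfig ν (B a) ∧ A a = B a} := by
  obtain ⟨e, he⟩ := exists_measurableEmbedding_real E
  have hD := measurableSet_finiteCell ν
  have hset : {a | IsConfig ν (A a) ∧ IsConfig ν (B a) ∧ A a = B a} =
      ⋂ k, {a | A a (finiteCell ν k) < ∞} ∩ ({a | B a (finiteCell ν k) < ∞} ∩
        ({a | A a (finiteCell ν k) = B a (finiteCell ν k)} ∩
        ⋂ q : ℚ, {a | A a (e ⁻¹' Set.Iic (q : ℝ) ∩ finiteCell ν k) =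
          B a (e ⁻¹' Set.Iic (q : ℝ) ∩ finiteCell ν k)})) := by
    ext a
    simp only [Set.mem_iInter, Set.mem_inter_iff, Set.mem_ofPred_eq]
    constructor
    · rintro ⟨h1, h2, h3⟩ k
      exact ⟨h1 k, h2 k, by rw [h3], fun q => by rw [h3]⟩
    · intro h
      refine ⟨fun k => (h k).1, fun k => (h k).2.1, eq_of_forall_finiteCell (ν := ν) fun k => ?_⟩
      obtain ⟨h1, -, h3, h4⟩ := h k
      have hfin : IsFiniteMeasure ((A a).restrict (finiteCell ν k)) :=
        ⟨by simpa using h1⟩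
      have key : ((A a).restrict (finiteCell ν k)).map e =
          ((B a).restrict (finiteCell ν k)).map e := by
        refine ext_of_generate_finite _
          (Real.borel_eq_generateFrom_Iic_rat ▸ BorelSpace.measurable_eq) Real.isPiSystem_Iic_rat ?_ ?_
        · intro s hs
          simp only [Set.mem_iUnion, Set.mem_singleton_iff] at hs
          obtain ⟨q, rfl⟩ := hs
          rw [he.map_apply, he.map_apply,
            Measure.restrict_apply (he.measurable measurableSet_Iic),
            Measure.restrict_apply (he.measurable measurableSet_Iic), h4 q]
        · rw [he.map_apply, he.map_apply]
          simpa using h3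
      ext s hs
      have := congrArg (fun ρ : Measure ℝ => ρ (e '' s)) key
      simpa only [he.map_apply, he.injective.preimage_image] using this
  rw [hset]
  have hc : ∀ s : Set E, MeasurableSet s → Measurable (fun a => A a s) ∧
      Measurable (fun a => B a s) := fun s hs =>
    ⟨(Measure.measurable_coe hs).comp hA, (Measure.measurable_coe hs).comp hB⟩
  refine MeasurableSet.iInter fun k => ?_
  obtain ⟨h1, h2⟩ := hc _ (hD k)
  refine (measurableSet_lt h1 measurable_const).inter ((measurableSet_lt h2 measurable_const).inter
    ((measurableSet_eq_fun h1 h2).inter (MeasurableSet.iInter fun q => ?_)))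
  obtain ⟨h3, h4⟩ := hc _ ((he.measurable measurableSet_Iic).inter (hD k) :
    MeasurableSet (e ⁻¹' Set.Iic (q : ℝ) ∩ finiteCell ν k))
  exact measurableSet_eq_fun h3 h4

end MeasurableEq

section Transition

variable {S : Type*} [MeasurableSpace S] {μ : Measure S} [SigmaFinite μ] {f : S → S → ℝ≥0}
  {Ω : Type*} {𝓕 mΩ : MeasurableSpace Ω} {P : Measure Ω} [IsProbabilityMeasure P]
  {X : Ω → S} {η : Ω → Measure (S × ℝ)} {Q : Measure (Measure (S × ℝ))}
  [StandardBorelSpace S] [Nonempty S]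

/-- The identity holds almost surely for each fixed state `x`. Integrating out the independent
configuration transfers it to the random state `X`, once the good event is jointly measurable. -/
lemma ae_unstep_step_of_indep (hQ : IsPoissonLaw (intensity μ) Q) (hf : IsTransitionDensity μ f)
    (h𝓕 : 𝓕 ≤ mΩ) (hX : Measurable[𝓕] X) (hη : Measurable η)
    (hi : Indep 𝓕 (MeasurableSpace.comap η inferInstance) P) (hηQ : P.map η = Q) :
    ∀ᵐ ω ∂P, unstep μ (f (X ω)) (step μ (f (X ω)) (η ω)).1 (step μ (f (X ω)) (η ω)).2 = η ω ∧
      0 < (step μ (f (X ω)) (η ω)).1.2 := by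
  have hs := measurable_uncurry_step hf
  have hF : Measurable (Function.uncurry fun p : S × Measure (S × ℝ) => f p.1) :=
    hf.measurable.comp (measurable_fst.fst.prodMk measurable_snd)
  have hu : Measurable fun p : S × Measure (S × ℝ) =>
      unstep μ (f p.1) (step μ (f p.1) p.2).1 (step μ (f p.1) p.2).2 :=
    measurable_unstep hF hs.snd hs.fst
  let G : Set (S × Measure (S × ℝ)) :=
    {p | IsConfig (intensity μ) (unstep μ (f p.1) (step μ (f p.1) p.2).1 (step μ (f p.1) p.2).2) ∧
      IsConfig (intensity μ) p.2 ∧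
      unstep μ (f p.1) (step μ (f p.1) p.2).1 (step μ (f p.1) p.2).2 = p.2} ∩
    {p | 0 < (step μ (f p.1) p.2).1.2}
  have hG : MeasurableSet G := (measurableSet_eq_of_isConfig hu measurable_snd).inter
    (measurableSet_lt measurable_const hs.fst.snd)
  have key := setLIntegral_of_indep h𝓕 hX hη hi (B := Set.univ) MeasurableSet.univ
    (F := Gᶜ.indicator 1) (measurable_one.indicator hG.compl)
  have hzero : ∀ x, ∫⁻ m, Gᶜ.indicator 1 (x, m) ∂Q = 0 := by
    intro x
    have hm : Measurable fun m : Measure (S × ℝ) =>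
        Gᶜ.indicator (1 : S × Measure (S × ℝ) → ℝ≥0∞) (x, m) :=
      (measurable_one.indicator hG.compl).comp measurable_prodMk_left
    rw [lintegral_eq_zero_iff hm]
    filter_upwards [hQ.ae_isConfig,
      hQ.ae_unstep_step (hf.measurable_left x) (hf.lintegral_eq_one x)] with m h1 h2
    refine Set.indicator_of_notMem (Set.notMem_compl_iff.2 ?_) _
    refine ⟨⟨?_, h1, h2.1⟩, h2.2⟩
    change IsConfig (intensity μ) (unstep μ (f x) (step μ (f x) m).1 (step μ (f x) m).2)
    rw [h2.1]; exact h1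
  rw [hηQ] at key
  simp only [hzero, lintegral_zero, Measure.restrict_univ] at key
  have hm : Measurable fun ω => Gᶜ.indicator (1 : S × Measure (S × ℝ) → ℝ≥0∞) (X ω, η ω) :=
    (measurable_one.indicator hG.compl).comp ((hX.mono h𝓕 le_rfl).prodMk hη)
  rw [lintegral_eq_zero_iff hm] at key
  filter_upwards [key] with ω hω
  have hmem : (X ω, η ω) ∈ G := by
    by_contra hne
    rw [Set.indicator_of_mem (by exact hne)] at hω
    exact one_ne_zero hω
  exact ⟨hmem.1.2.2, hmem.2⟩

/-- Integrating out `η`, then `W` under its conditional law, leaves `Q D` whatever the state is, by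
`map_unstep`. Independence survives only with respect to `𝓕`, since `W` has become part of the
configuration. -/
lemma indep_unstep {W : Ω → S × ℝ} (hQ : IsPoissonLaw (intensity μ) Q)
    (hf : IsTransitionDensity μ f) (h𝓕 : 𝓕 ≤ mΩ) (hX : Measurable[𝓕] X) (hW : Measurable W)
    (hη : Measurable η)
    (hlaw : CondLaw P 𝓕 W X (stepKernel μ f))
    (hi : Indep (𝓕 ⊔ MeasurableSpace.comap W inferInstance)
      (MeasurableSpace.comap η inferInstance) P) (hηQ : P.map η = Q) :
    Indep 𝓕 (MeasurableSpace.comap (fun ω => unstep μ (f (X ω)) (W ω) (η ω)) inferInstance) P ∧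
    P.map (fun ω => unstep μ (f (X ω)) (W ω) (η ω)) = Q := by
  have := hQ.isProbabilityMeasure
  have := isMarkovKernel_stepKernel hf
  have hF : Measurable (Function.uncurry fun p : (S × (S × ℝ)) × Measure (S × ℝ) => f p.1.1) :=
    hf.measurable.comp (measurable_fst.fst.fst.prodMk measurable_snd)
  have hu : Measurable fun p : (S × (S × ℝ)) × Measure (S × ℝ) => unstep μ (f p.1.1) p.1.2 p.2 :=
    measurable_unstep hF measurable_snd measurable_fst.snd
  have hX' : Measurable X := hX.mono h𝓕 le_rfl
  have huΩ : Measurable fun ω => unstep μ (f (X ω)) (W ω) (η ω) :=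
    (hu.comp ((hX'.prodMk hW).prodMk hη) :)
  have hXW : Measurable[𝓕 ⊔ MeasurableSpace.comap W inferInstance] fun ω => (X ω, W ω) :=
    (hX.mono le_sup_left le_rfl).prodMk
      (measurable_iff_comap_le.2 (le_sup_right (a := 𝓕)))
  have key : ∀ B, MeasurableSet[𝓕] B → ∀ D, MeasurableSet D →
      P (B ∩ (fun ω => unstep μ (f (X ω)) (W ω) (η ω)) ⁻¹' D) = P B * Q D := by
    intro B hB D hD
    have hFD : Measurable fun p : (S × (S × ℝ)) × Measure (S × ℝ) =>
        D.indicator (1 : Measure (S × ℝ) → ℝ≥0∞) (unstep μ (f p.1.1) p.1.2 p.2) :=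
      (measurable_one.indicator hD).comp hu
    have e1 := setLIntegral_of_indep (sup_le h𝓕 (measurable_iff_comap_le.1 hW)) hXW hη hi
      (le_sup_left (b := MeasurableSpace.comap W inferInstance) B hB) hFD
    have e2 := hlaw.setLIntegral h𝓕 hX hW hB
      (F := fun p => ∫⁻ m, D.indicator (1 : Measure (S × ℝ) → ℝ≥0∞) (unstep μ (f p.1) p.2 m) ∂Q)
      hFD.lintegral_prod_right'
    have e3 : ∀ x, ∫⁻ w, ∫⁻ m, D.indicator (1 : Measure (S × ℝ) → ℝ≥0∞) (unstep μ (f x) w m) ∂Q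
        ∂(stepKernel μ f x) = Q D := by
      intro x
      have hux : Measurable fun q : (S × ℝ) × Measure (S × ℝ) => unstep μ (f x) q.1 q.2 :=
        (hu.comp ((measurable_const.prodMk measurable_fst).prodMk measurable_snd) :)
      have h1 := DFunLike.congr_fun
        (hQ.map_unstep (hf.measurable_left x) (hf.lintegral_eq_one x)) D
      rw [← stepKernel_apply hf, ← lintegral_indicator_one hD,
        lintegral_map (measurable_one.indicator hD) hux, MeasureTheory.lintegral_prod
          (fun q => D.indicator (1 : Measure (S × ℝ) → ℝ≥0∞) (unstep μ (f x) q.1 q.2))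
          ((measurable_one.indicator hD).comp hux).aemeasurable] at h1
      exact h1
    rw [hηQ] at e1
    rw [Set.inter_comm, ← Measure.restrict_apply (huΩ hD), ← lintegral_indicator_one (huΩ hD)]
    refine Eq.trans ?_ ((e1.trans e2).trans ?_)
    · rfl
    · simp only [e3, lintegral_const, Measure.restrict_apply MeasurableSet.univ, Set.univ_inter]
      rw [mul_comm]
  have hmap : P.map (fun ω => unstep μ (f (X ω)) (W ω) (η ω)) = Q := by
    ext D hD
    rw [Measure.map_apply huΩ hD]
    simpa using key Set.univ MeasurableSet.univ D hD
  refine ⟨(Indep_iff _ _ _).2 ?_, hmap⟩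
  rintro B _ hB ⟨D, hD, rfl⟩
  rw [key B hB D hD, ← Measure.map_apply huΩ hD, hmap]

end Transition

/-! ### Markov chains with independent exponential marks -/

lemma measurable_indicator_one {Ω : Type*} {m : MeasurableSpace Ω} {B : Set Ω}
    (hB : MeasurableSet B) : Measurable (B.indicator (1 : Ω → ℝ≥0∞)) :=
  measurable_one.indicator hB

section Markov

variable {Ω S : Type*} {mΩ : MeasurableSpace Ω} [MeasurableSpace S] {μ : Measure S} [SigmaFinite μ]
  {P : Measure Ω} {f : S → S → ℝ≥0}

lemma integral_density_eq (hf : IsTransitionDensity μ f) (x : S) {A : Set S}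
    (hA : MeasurableSet A) : ∫ z in A, (f x z : ℝ) ∂μ = (transKernel μ f x A).toReal := by
  rw [transKernel_apply hf, withDensity_apply _ hA, integral_eq_lintegral_of_nonneg_ae]
  · simp
  · exact Filter.Eventually.of_forall fun z => (f x z).2
  · exact (hf.measurable_left x).coe_nnreal_real.aestronglyMeasurable

lemma setIntegral_toReal_kernel {K : Kernel S S} [IsMarkovKernel K] {X : Ω → S}
    (hX : Measurable X) {A : Set S} (hA : MeasurableSet A) (B : Set Ω) :
    ∫ ω in B, (K (X ω) A).toReal ∂P = (∫⁻ ω in B, K (X ω) A ∂P).toReal :=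
  integral_toReal ((K.measurable_coe hA).comp hX).aemeasurable
    (Filter.Eventually.of_forall fun _ => measure_lt_top _ _)

variable [IsProbabilityMeasure P]

lemma integrable_toReal_kernel {K : Kernel S S} [IsMarkovKernel K] {X : Ω → S}
    (hX : Measurable X) {A : Set S} (hA : MeasurableSet A) :
    Integrable (fun ω => (K (X ω) A).toReal) P := by
  refine Integrable.of_bound
    ((K.measurable_coe hA).comp hX).ennreal_toReal.aestronglyMeasurable 1
    (Filter.Eventually.of_forall fun ω => ?_)
  rw [Real.norm_of_nonneg ENNReal.toReal_nonneg]
  exact measureReal_le_one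

lemma IsMarkovChain.condLaw {g : ℕ → S → S → ℝ≥0} {Z : ℕ → Ω → S}
    (hg : ∀ i ≥ 1, IsTransitionDensity μ (g i)) (h : IsMarkovChain P μ g Z) (n : ℕ) :
    CondLaw P (hist Z n) (Z (n + 1)) (Z n) (transKernel μ (g (n + 1))) := by
  intro B hB A hA
  have hgn := hg (n + 1) (by omega)
  have := isMarkovKernel_transKernel hgn
  have hle := hist_le h.measurable n
  have hpre : MeasurableSet (Z (n + 1) ⁻¹' A) := h.measurable _ hA
  have e1 : ∫ ω in B, (P⟦Z (n + 1) ⁻¹' A | hist Z n⟧) ω ∂P = (P (B ∩ Z (n + 1) ⁻¹' A)).toReal := by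
    rw [setIntegral_condExp hle ((integrable_const (1 : ℝ)).indicator hpre) hB,
      integral_indicator hpre, Measure.restrict_restrict hpre, setIntegral_const, smul_eq_mul,
      mul_one, Set.inter_comm]
    rfl
  rw [setIntegral_congr_ae (hle B hB) ((h.condProb n A hA).mono fun ω hω _ => hω)] at e1
  simp_rw [integral_density_eq hgn _ hA] at e1
  rw [setIntegral_toReal_kernel (h.measurable n) hA] at e1
  refine ((ENNReal.toReal_eq_toReal_iff' ?_ ?_).1 e1).symm
  · refine ((lintegral_mono fun ω => prob_le_one).trans_lt ?_).ne
    simp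
  · exact measure_ne_top _ _

lemma isMarkovChain_of_condLaw {g : ℕ → S → S → ℝ≥0} {Z : ℕ → Ω → S}
    (hg : ∀ i ≥ 1, IsTransitionDensity μ (g i)) (hZ : ∀ i, Measurable (Z i))
    (h : ∀ n, CondLaw P (hist Z n) (Z (n + 1)) (Z n) (transKernel μ (g (n + 1)))) :
    IsMarkovChain P μ g Z := by
  refine ⟨hZ, fun n A hA => ?_⟩
  have hgn := hg (n + 1) (by omega)
  have := isMarkovKernel_transKernel hgn
  have hle := hist_le hZ n
  have hpre : MeasurableSet (Z (n + 1) ⁻¹' A) := hZ _ hA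
  simp_rw [integral_density_eq hgn _ hA]
  symm
  refine ae_eq_condExp_of_forall_setIntegral_eq hle ((integrable_const (1 : ℝ)).indicator hpre)
    (fun B _ _ => (integrable_toReal_kernel (hZ n) hA).integrableOn) ?_ ?_
  · intro B hB _
    rw [setIntegral_toReal_kernel (hZ n) hA, ← h n B hB A hA, integral_indicator hpre,
      Measure.restrict_restrict hpre, setIntegral_const, smul_eq_mul, mul_one, Set.inter_comm]
    rfl
  · refine StronglyMeasurable.aestronglyMeasurable ?_
    exact (((transKernel μ (g (n + 1))).measurable_coe hA).comp
      (measurable_hist le_rfl)).ennreal_toReal.stronglyMeasurable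

end Markov

section Independence

variable {Ω : Type*} {mΩ : MeasurableSpace Ω} {P : Measure Ω}

lemma iIndepFun_of_indep_hist [IsProbabilityMeasure P] {X : ℕ → Ω → ℝ}
    (h : ∀ n, Indep (hist X n) (MeasurableSpace.comap (X (n + 1)) inferInstance) P) :
    iIndepFun (fun k => X (k + 1)) P := by
  rw [iIndepFun_iff_measure_inter_preimage_eq_mul]
  intro s sets hsets
  induction s using Finset.induction_on_max with
  | empty => simp
  | insert a s hs ih =>
    have ha : a ∉ s := fun h => (hs a h).false
    rw [Finset.prod_insert ha, Finset.set_biInter_insert, Set.inter_comm,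
      ← ih fun i hi => hsets i (Finset.mem_insert_of_mem hi), mul_comm]
    refine (Indep_iff _ _ _).1 (h a) _ _ ?_ ⟨_, hsets a (Finset.mem_insert_self _ _), rfl⟩
    exact Finset.measurableSet_biInter _ fun i hi =>
      measurable_hist (hs i hi) (hsets i (Finset.mem_insert_of_mem hi))

lemma indep_hist_of_iIndepFun {X : ℕ → Ω → ℝ} {c : ℝ} (h0 : ∀ ω, X 0 ω = c)
    (hX : ∀ n, Measurable (X n)) (h : iIndepFun (fun k => X (k + 1)) P) (n : ℕ) :
    Indep (hist X n) (MeasurableSpace.comap (X (n + 1)) inferInstance) P := by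
  have hi := indep_iSup_of_disjoint (m := fun k => MeasurableSpace.comap (X (k + 1)) inferInstance)
    (fun k => measurable_iff_comap_le.1 (hX _)) h (S := Set.Iio n) (T := {n})
    (by simp)
  simp only [Set.mem_singleton_iff, iSup_iSup_eq_left] at hi
  refine indep_of_indep_of_le_left hi (iSup₂_le fun j hj => ?_)
  rcases j with _ | j
  · have : X 0 = fun _ => c := funext h0
    rw [this, MeasurableSpace.comap_const]
    exact bot_le
  · exact le_iSup₂ (f := fun j (_ : j ∈ Set.Iio n) =>
      MeasurableSpace.comap (X (j + 1)) inferInstance) j (Set.mem_Iio.2 hj)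

lemma indepFun_of_indep_hist [IsProbabilityMeasure P] {S : Type*} [MeasurableSpace S]
    {X : ℕ → Ω → ℝ} {Z : ℕ → Ω → S}
    (hX : ∀ n, Measurable (X n)) (hZ : ∀ n, Measurable (Z n))
    (h : ∀ n, Indep (hist X n) (hist Z n) P) :
    IndepFun (fun ω (k : ℕ) => X (k + 1) ω) (fun ω (i : ℕ) => Z i ω) P := by
  rw [IndepFun_iff_Indep, comap_pi_eq_iSup (fun k => X (k + 1)), comap_pi_eq_iSup Z]
  have h1 : ∀ m n, Indep (hist X m) (hist Z n) P := fun m n =>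
    indep_of_indep_of_le_left (indep_of_indep_of_le_right (h (max m n))
      (monotone_hist (le_max_right m n))) (monotone_hist (le_max_left m n))
  have h2 : ∀ n, Indep (⨆ m, hist X m) (hist Z n) P := fun n =>
    indep_iSup_of_monotone (fun m => h1 m n) (hist_le hX) (hist_le hZ n) monotone_hist
  have h3 : Indep (⨆ n, hist Z n) (⨆ m, hist X m) P :=
    indep_iSup_of_monotone (fun n => (h2 n).symm) (hist_le hZ) (iSup_le (hist_le hX)) monotone_hist
  refine indep_of_indep_of_le_left (indep_of_indep_of_le_right h3.symm ?_) ?_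
  · exact iSup_le fun i => (comap_le_hist le_rfl).trans (le_iSup (hist Z) i)
  · exact iSup_le fun i => (comap_le_hist (W := X) le_rfl).trans (le_iSup (hist X) (i + 1))

end Independence

section Chain

variable {Ω S : Type*} {mΩ : MeasurableSpace Ω} [MeasurableSpace S] {μ : Measure S} [SigmaFinite μ]
  {P : Measure Ω} {g : ℕ → S → S → ℝ≥0} {Z : ℕ → Ω → S} {X : ℕ → Ω → ℝ}

/-- A chain with independent exponential marks, described by the conditional laws of its steps. -/
structure IsMarkedChain (P : Measure Ω) (μ : Measure S) [SigmaFinite μ] (g : ℕ → S → S → ℝ≥0)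
    (Z : ℕ → Ω → S) (X : ℕ → Ω → ℝ) : Prop where
  measurable_chain : ∀ n, Measurable (Z n)
  measurable_mark : ∀ n, Measurable (X n)
  condLaw : ∀ n, CondLaw P (hist (fun j ω => (Z j ω, X j ω)) n)
    (fun ω => (Z (n + 1) ω, X (n + 1) ω)) (Z n) (stepKernel μ (g (n + 1)))

lemma IsMarkedChain.measurable (h : IsMarkedChain P μ g Z X) (n : ℕ) :
    Measurable fun ω => (Z n ω, X n ω) :=
  (h.measurable_chain n).prodMk (h.measurable_mark n)

lemma IsMarkedChain.hist_chain_le (n : ℕ) : hist Z n ≤ hist (fun j ω => (Z j ω, X j ω)) n :=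
  hist_comp_le (W := fun j ω => (Z j ω, X j ω)) measurable_fst n

lemma IsMarkedChain.hist_mark_le (n : ℕ) : hist X n ≤ hist (fun j ω => (Z j ω, X j ω)) n :=
  hist_comp_le (W := fun j ω => (Z j ω, X j ω)) measurable_snd n

lemma IsMarkedChain.measure_inter (h : IsMarkedChain P μ g Z X)
    (hg : ∀ i ≥ 1, IsTransitionDensity μ (g i)) (n : ℕ) {B : Set Ω}
    (hB : MeasurableSet[hist (fun j ω => (Z j ω, X j ω)) n] B) {A : Set S} (hA : MeasurableSet A)
    {C : Set ℝ} (hC : MeasurableSet C) :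
    P (B ∩ (Z (n + 1) ⁻¹' A ∩ X (n + 1) ⁻¹' C)) =
      (∫⁻ ω in B, transKernel μ (g (n + 1)) (Z n ω) A ∂P) * expMeasure 1 C := by
  have := h.condLaw n B hB (A ×ˢ C) (hA.prod hC)
  simp_rw [stepKernel_prod (hg (n + 1) (by omega))] at this
  rw [lintegral_mul_const _ (by
    exact ((transKernel μ (g (n + 1))).measurable_coe hA).comp (h.measurable_chain n))] at this
  exact this

lemma IsMarkedChain.measure_inter_mark (h : IsMarkedChain P μ g Z X)
    (hg : ∀ i ≥ 1, IsTransitionDensity μ (g i)) (n : ℕ) {B : Set Ω}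
    (hB : MeasurableSet[hist (fun j ω => (Z j ω, X j ω)) n] B)
    {C : Set ℝ} (hC : MeasurableSet C) :
    P (B ∩ X (n + 1) ⁻¹' C) = P B * expMeasure 1 C := by
  have := isMarkovKernel_transKernel (hg (n + 1) (by omega))
  have := h.measure_inter hg n hB MeasurableSet.univ hC
  simpa using this

variable [IsProbabilityMeasure P]

lemma IsMarkedChain.isMarkovChain (h : IsMarkedChain P μ g Z X)
    (hg : ∀ i ≥ 1, IsTransitionDensity μ (g i)) : IsMarkovChain P μ g Z := by
  refine isMarkovChain_of_condLaw hg h.measurable_chain fun n B hB A hA => ?_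
  have := h.measure_inter hg n (IsMarkedChain.hist_chain_le n B hB) hA MeasurableSet.univ
  simpa using this

lemma IsMarkedChain.map_mark (h : IsMarkedChain P μ g Z X)
    (hg : ∀ i ≥ 1, IsTransitionDensity μ (g i)) (n : ℕ) : P.map (X (n + 1)) = expMeasure 1 := by
  ext C hC
  rw [Measure.map_apply (h.measurable_mark _) hC]
  simpa using h.measure_inter_mark hg n MeasurableSet.univ hC

lemma IsMarkedChain.isIIDExp (h : IsMarkedChain P μ g Z X)
    (hg : ∀ i ≥ 1, IsTransitionDensity μ (g i)) : IsIIDExp P X := by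
  refine ⟨fun k _ => h.measurable_mark k, fun k hk => ?_, iIndepFun_of_indep_hist fun n => ?_⟩
  · obtain ⟨n, rfl⟩ := Nat.exists_eq_add_of_le' hk
    exact h.map_mark hg n
  · refine (Indep_iff _ _ _).2 ?_
    rintro B _ hB ⟨C, hC, rfl⟩
    rw [h.measure_inter_mark hg n (IsMarkedChain.hist_mark_le n B hB) hC, ← h.map_mark hg n,
      Measure.map_apply (h.measurable_mark _) hC]

/-- Both pasts grow together. The new mark is independent of the joint past and the new state, while
the law of the new state is a function of the chain's past alone, which is independent of the
earlier marks. The constant `X 0` makes the initial past of the marks trivial. -/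
lemma IsMarkedChain.indep_hist (h : IsMarkedChain P μ g Z X)
    (hg : ∀ i ≥ 1, IsTransitionDensity μ (g i)) {c : ℝ} (h0 : ∀ ω, X 0 ω = c) (n : ℕ) :
    Indep (hist X n) (hist Z n) P := by
  induction n with
  | zero =>
    have : X 0 = fun _ => c := funext h0
    rw [hist_zero, this, MeasurableSpace.comap_const]
    exact indep_bot_left _
  | succ n ih =>
    rw [hist_succ, hist_succ]
    refine indep_sup_of_inter (hist_le h.measurable_mark n)
      (measurable_iff_comap_le.1 (h.measurable_mark _)) (hist_le h.measurable_chain n)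
      (measurable_iff_comap_le.1 (h.measurable_chain _)) ?_
    rintro B _ B' _ hB ⟨C, hC, rfl⟩ hB' ⟨A, hA, rfl⟩
    have hBW := IsMarkedChain.hist_mark_le (Z := Z) n B hB
    have hBW' := IsMarkedChain.hist_chain_le (X := X) n B' hB'
    have hset : (B ∩ X (n + 1) ⁻¹' C) ∩ (B' ∩ Z (n + 1) ⁻¹' A) =
        (B ∩ B') ∩ (Z (n + 1) ⁻¹' A ∩ X (n + 1) ⁻¹' C) := by
      ext ω; simp only [Set.mem_inter_iff]; tauto
    have e1 := h.measure_inter hg n hBW' hA MeasurableSet.univ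
    rw [Set.preimage_univ, Set.inter_univ, measure_univ, mul_one] at e1
    rw [hset, h.measure_inter hg n (hBW.inter hBW') hA hC, h.measure_inter_mark hg n hBW hC, e1]
    have hZ : Measurable[hist Z n] fun ω => transKernel μ (g (n + 1)) (Z n ω) A :=
      ((transKernel μ (g (n + 1))).measurable_coe hA).comp (measurable_hist le_rfl)
    have hBm := hist_le h.measurable_mark n B hB
    have hBm' := hist_le h.measurable_chain n B' hB'
    have e2 := lintegral_mul_eq_lintegral_mul_lintegral_of_independent_measurableSpace
      (hist_le h.measurable_mark n) (hist_le h.measurable_chain n) ih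
      (f := B.indicator 1)
      (g := B'.indicator fun ω => transKernel μ (g (n + 1)) (Z n ω) A)
      (measurable_indicator_one hB) (Measurable.indicator hZ hB')
    rw [lintegral_indicator_one hBm, lintegral_indicator hBm'] at e2
    have e3 : ∫⁻ ω in B ∩ B', transKernel μ (g (n + 1)) (Z n ω) A ∂P =
        P B * ∫⁻ ω in B', transKernel μ (g (n + 1)) (Z n ω) A ∂P := by
      rw [← e2, ← lintegral_indicator (hBm.inter hBm')]
      refine lintegral_congr fun ω => ?_
      by_cases h1 : ω ∈ B <;> by_cases h2 : ω ∈ B' <;> simp [Set.indicator, h1, h2]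
    rw [e3]
    ring

/-- A Markov chain together with independent exponential variables is a marked chain. -/
lemma isMarkedChain_of_indepFun (hg : ∀ i ≥ 1, IsTransitionDensity μ (g i))
    (hZ : IsMarkovChain P μ g Z) (hXm : ∀ n, Measurable (X n)) {c : ℝ} (h0 : ∀ ω, X 0 ω = c)
    (hX : IsIIDExp P X)
    (hi : IndepFun (fun ω (i : ℕ) => Z i ω) (fun ω (k : ℕ) => X (k + 1) ω) P) :
    IsMarkedChain P μ g Z X := by
  refine ⟨hZ.measurable, hXm, fun n => ?_⟩
  have hgn := hg (n + 1) (by omega)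
  have := isMarkovKernel_transKernel hgn
  have := isMarkovKernel_stepKernel hgn
  have hWm : ∀ n, Measurable fun ω => (Z n ω, X n ω) := fun n => (hZ.measurable n).prodMk (hXm n)
  have hK : ∀ D, MeasurableSet D → Measurable fun ω => stepKernel μ (g (n + 1)) (Z n ω) D :=
    fun D hD => ((stepKernel μ (g (n + 1))).measurable_coe hD).comp (hZ.measurable n)
  have hhist : hist (fun j ω => (Z j ω, X j ω)) n ≤ hist Z n ⊔ hist X n := by
    refine iSup₂_le fun j hj => ?_
    rw [← measurable_iff_comap_le]
    exact ((measurable_hist hj).mono le_sup_left le_rfl).prodMk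
      ((measurable_hist hj).mono le_sup_right le_rfl)
  have hind : Indep (hist Z (n + 1)) (hist X (n + 1)) P := by
    rw [IndepFun_iff_Indep, comap_pi_eq_iSup (fun k => X (k + 1)), comap_pi_eq_iSup Z] at hi
    refine indep_of_indep_of_le_left (indep_of_indep_of_le_right hi ?_) ?_
    · refine iSup₂_le fun j hj => ?_
      rcases j with _ | j
      · have : X 0 = fun _ => c := funext h0
        rw [this, MeasurableSpace.comap_const]
        exact bot_le
      · exact le_iSup (fun j => MeasurableSpace.comap (X (j + 1)) inferInstance) j
    · exact iSup₂_le fun j hj => le_iSup (fun j => MeasurableSpace.comap (Z j) inferInstance) j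
  -- Rectangles in the new pair are tested first against products of a chain event and a mark event,
  -- then against all joint past events by a π-system argument.
  have hrect : ∀ A C, MeasurableSet A → MeasurableSet C →
      ∀ B, MeasurableSet[hist Z n ⊔ hist X n] B →
      P (B ∩ (fun ω => (Z (n + 1) ω, X (n + 1) ω)) ⁻¹' (A ×ˢ C)) =
        ∫⁻ ω in B, stepKernel μ (g (n + 1)) (Z n ω) (A ×ˢ C) ∂P := by
    intro A C hA hC B hB
    have hle : hist Z n ⊔ hist X n ≤ mΩ := sup_le (hist_le hZ.measurable n) (hist_le hXm n)
    let E : Set Ω := (fun ω => (Z (n + 1) ω, X (n + 1) ω)) ⁻¹' (A ×ˢ C)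
    have hE : MeasurableSet E := hWm (n + 1) (hA.prod hC)
    have hinter : ∀ B₁ B₂, MeasurableSet[hist Z n] B₁ → MeasurableSet[hist X n] B₂ →
        P ((B₁ ∩ B₂) ∩ E) = ∫⁻ ω in B₁ ∩ B₂, stepKernel μ (g (n + 1)) (Z n ω) (A ×ˢ C) ∂P := by
      intro B₁ B₂ hB₁ hB₂
      have hset : (B₁ ∩ B₂) ∩ E = (B₁ ∩ Z (n + 1) ⁻¹' A) ∩ (B₂ ∩ X (n + 1) ⁻¹' C) := by
        ext ω
        simp only [E, Set.mem_inter_iff, Set.mem_preimage, Set.mem_prod]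
        tauto
      have h1 := (Indep_iff _ _ _).1 hind (B₁ ∩ Z (n + 1) ⁻¹' A) (B₂ ∩ X (n + 1) ⁻¹' C)
        ((monotone_hist n.le_succ B₁ hB₁).inter (measurable_hist le_rfl hA))
        ((monotone_hist n.le_succ B₂ hB₂).inter (measurable_hist le_rfl hC))
      have h2 := (Indep_iff _ _ _).1 (indep_hist_of_iIndepFun h0 hXm hX.indep n) B₂
        (X (n + 1) ⁻¹' C) hB₂ ⟨C, hC, rfl⟩
      rw [← Measure.map_apply (hXm (n + 1)) hC, hX.law (n + 1) (by omega)] at h2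
      rw [hset, h1, h2, hZ.condLaw hg n B₁ hB₁ A hA]
      simp_rw [stepKernel_prod hgn]
      have hZn : Measurable[hist Z n] fun ω => transKernel μ (g (n + 1)) (Z n ω) A :=
        ((transKernel μ (g (n + 1))).measurable_coe hA).comp (measurable_hist le_rfl)
      rw [lintegral_mul_const _ (hZn.mono (hist_le hZ.measurable n) le_rfl)]
      have hBm := hist_le hZ.measurable n B₁ hB₁
      have hBm' := hist_le hXm n B₂ hB₂
      have e2 := lintegral_mul_eq_lintegral_mul_lintegral_of_independent_measurableSpace
        (hist_le hZ.measurable n) (hist_le hXm n)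
        (indep_of_indep_of_le_left (indep_of_indep_of_le_right hind (monotone_hist n.le_succ))
          (monotone_hist n.le_succ))
        (f := B₁.indicator fun ω => transKernel μ (g (n + 1)) (Z n ω) A)
        (g := B₂.indicator 1)
        (Measurable.indicator hZn hB₁) (measurable_indicator_one hB₂)
      rw [lintegral_indicator_one hBm', lintegral_indicator hBm] at e2
      have e3 : ∫⁻ ω in B₁ ∩ B₂, transKernel μ (g (n + 1)) (Z n ω) A ∂P =
          (∫⁻ ω in B₁, transKernel μ (g (n + 1)) (Z n ω) A ∂P) * P B₂ := by
        rw [← e2, ← lintegral_indicator (hBm.inter hBm')]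
        refine lintegral_congr fun ω => ?_
        by_cases h1 : ω ∈ B₁ <;> by_cases h2 : ω ∈ B₂ <;> simp [Set.indicator, h1, h2]
      rw [e3]
      ring
    have key := ext_on_measurableSpace_of_generate_finite mΩ (μ := P.restrict E)
      (ν := P.withDensity fun ω => stepKernel μ (g (n + 1)) (Z n ω) (A ×ˢ C))
      _ ?_ hle (sup_eq_generateFrom_inter _ _) (isPiSystem_inter_measurableSet _ _) ?_ hB
    · rwa [Measure.restrict_apply (hle B hB), withDensity_apply _ (hle B hB)] at key
    · rintro _ ⟨B₁, B₂, hB₁, hB₂, rfl⟩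
      have hm := (hist_le hZ.measurable n B₁ hB₁).inter (hist_le hXm n B₂ hB₂)
      rw [Measure.restrict_apply hm, withDensity_apply _ hm]
      exact hinter B₁ B₂ hB₁ hB₂
    · rw [Measure.restrict_apply MeasurableSet.univ, withDensity_apply _ MeasurableSet.univ]
      simpa using hinter Set.univ Set.univ MeasurableSet.univ MeasurableSet.univ
  intro B hB D hD
  have hKm : Measurable fun ω => stepKernel μ (g (n + 1)) (Z n ω) :=
    (stepKernel μ (g (n + 1))).measurable.comp (hZ.measurable n)
  have key : (P.restrict B).map (fun ω => (Z (n + 1) ω, X (n + 1) ω)) =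
      (P.restrict B).bind fun ω => stepKernel μ (g (n + 1)) (Z n ω) := by
    refine Measure.ext_prod fun {A C} hA hC => ?_
    rw [Measure.map_apply (hWm _) (hA.prod hC),
      Measure.restrict_apply (hWm _ (hA.prod hC)), Set.inter_comm,
      hrect A C hA hC B (hhist B hB), Measure.bind_apply (hA.prod hC) hKm.aemeasurable]
  have := DFunLike.congr_fun key D
  rwa [Measure.map_apply (hWm _) hD, Measure.restrict_apply (hWm _ hD), Set.inter_comm,
    Measure.bind_apply hD hKm.aemeasurable] at this

end Chain

/-! ### Backward filling and forward exploration -/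

section Explore

lemma measurable_fst_hist {Ω S : Type*} [MeasurableSpace S] {W : ℕ → Ω → S × ℝ} (n : ℕ) :
    Measurable[hist W n] fun ω => (W n ω).1 :=
  measurable_fst.comp (measurable_hist le_rfl)

variable {Ω S : Type*} {mΩ : MeasurableSpace Ω} [MeasurableSpace S]
  (μ : Measure S) [SigmaFinite μ]

/-- The configurations obtained from `m` by successively inserting the points described by
`w T, …, w (i + 1)`. -/
noncomputable def fill (g : ℕ → S → S → ℝ≥0) (w : ℕ → S × ℝ) (T : ℕ) (m : Measure (S × ℝ))
    (i : ℕ) : Measure (S × ℝ) :=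
  if i < T then unstep μ (g (i + 1) (w i).1) (w (i + 1)) (fill g w T m (i + 1)) else m
termination_by T - i

/-- Successive exploration steps from the starting point `z`. -/
noncomputable def explore [StandardBorelSpace S] [Nonempty S] (g : ℕ → S → S → ℝ≥0) (z : S)
    (m : Measure (S × ℝ)) : ℕ → (S × ℝ) × Measure (S × ℝ)
  | 0 => ((z, 0), m)
  | n + 1 => step μ (g (n + 1) (explore g z m n).1.1) (explore g z m n).2

variable {μ} {P : Measure Ω} [IsProbabilityMeasure P] {Q : Measure (Measure (S × ℝ))}
  {g : ℕ → S → S → ℝ≥0} {η : Ω → Measure (S × ℝ)} [StandardBorelSpace S] [Nonempty S]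

lemma measurable_explore (hg : ∀ i ≥ 1, IsTransitionDensity μ (g i)) (hη : Measurable η) (z : S)
    (n : ℕ) : Measurable fun ω => explore μ g z (η ω) n := by
  induction n with
  | zero => exact measurable_const.prodMk hη
  | succ n ih =>
    exact ((measurable_uncurry_step (hg (n + 1) (by omega))).comp (ih.fst.fst.prodMk ih.snd) :)

lemma indep_explore (hQ : IsPoissonLaw (intensity μ) Q)
    (hg : ∀ i ≥ 1, IsTransitionDensity μ (g i)) (hη : Measurable η) (hηQ : P.map η = Q) (z : S)
    (n : ℕ) :
    Indep (hist (fun j ω => (explore μ g z (η ω) j).1) n)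
      (MeasurableSpace.comap (fun ω => (explore μ g z (η ω) n).2) inferInstance) P ∧
    P.map (fun ω => (explore μ g z (η ω) n).2) = Q := by
  have hm := measurable_explore hg hη z
  induction n with
  | zero =>
    refine ⟨?_, hηQ⟩
    rw [hist_zero]
    change Indep (MeasurableSpace.comap (fun _ => (z, 0)) inferInstance) _ P
    rw [MeasurableSpace.comap_const]
    exact indep_bot_left _
  | succ n ih =>
    rw [hist_succ]
    exact indep_step hQ (hg (n + 1) (by omega)) (hist_le (fun j => (hm j).fst) n)
      (measurable_fst_hist n) (hm n).snd ih.1 ih.2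

lemma isMarkedChain_explore (hQ : IsPoissonLaw (intensity μ) Q)
    (hg : ∀ i ≥ 1, IsTransitionDensity μ (g i)) (hη : Measurable η) (hηQ : P.map η = Q) (z : S) :
    IsMarkedChain P μ g (fun n ω => (explore μ g z (η ω) n).1.1)
      (fun n ω => (explore μ g z (η ω) n).1.2) := by
  have hm := measurable_explore hg hη z
  refine ⟨fun n => (hm n).fst.fst, fun n => (hm n).fst.snd, fun n => ?_⟩
  obtain ⟨h1, h2⟩ := indep_explore hQ hg hη hηQ z n
  exact condLaw_step hQ (hg (n + 1) (by omega)) (hist_le (fun j => (hm j).fst) n)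
    (measurable_fst_hist n) (hm n).snd h1 h2

lemma ae_explore (hQ : IsPoissonLaw (intensity μ) Q)
    (hg : ∀ i ≥ 1, IsTransitionDensity μ (g i)) (hη : Measurable η) (hηQ : P.map η = Q) (z : S)
    (n : ℕ) :
    ∀ᵐ ω ∂P, unstep μ (g (n + 1) (explore μ g z (η ω) n).1.1) (explore μ g z (η ω) (n + 1)).1
        (explore μ g z (η ω) (n + 1)).2 = (explore μ g z (η ω) n).2 ∧
      0 < (explore μ g z (η ω) (n + 1)).1.2 := by
  have hm := measurable_explore hg hη z
  obtain ⟨h1, h2⟩ := indep_explore hQ hg hη hηQ z n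
  exact ae_unstep_step_of_indep hQ (hg (n + 1) (by omega)) (hist_le (fun j => (hm j).fst) n)
    (measurable_fst_hist n) (hm n).snd h1 h2

/-- Downward induction from `T`: each insertion moves the pair of index `i + 1` out of the past and
into the configuration, which stays Poisson and independent of what remains of the past. -/
lemma fill_spec {Z : ℕ → Ω → S} {X : ℕ → Ω → ℝ} (hQ : IsPoissonLaw (intensity μ) Q)
    (hg : ∀ i ≥ 1, IsTransitionDensity μ (g i)) (h : IsMarkedChain P μ g Z X) {T : ℕ}
    (hη : Measurable η) (hηQ : P.map η = Q)
    (hi : Indep (hist (fun j ω => (Z j ω, X j ω)) T) (MeasurableSpace.comap η inferInstance) P)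
    {i : ℕ} (hiT : i ≤ T) :
    Measurable (fun ω => fill μ g (fun j => (Z j ω, X j ω)) T (η ω) i) ∧
    Indep (hist (fun j ω => (Z j ω, X j ω)) i) (MeasurableSpace.comap
      (fun ω => fill μ g (fun j => (Z j ω, X j ω)) T (η ω) i) inferInstance) P ∧
    P.map (fun ω => fill μ g (fun j => (Z j ω, X j ω)) T (η ω) i) = Q := by
  induction hiT using Nat.decreasingInduction with
  | self =>
    have : (fun ω => fill μ g (fun j => (Z j ω, X j ω)) T (η ω) T) = η := by
      funext ω
      rw [fill, if_neg (lt_irrefl T)]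
    rw [this]
    exact ⟨hη, hi, hηQ⟩
  | of_succ i hiT ih =>
    obtain ⟨h1, h2, h3⟩ := ih
    have hgi := hg (i + 1) (by omega)
    have hfun : (fun ω => fill μ g (fun j => (Z j ω, X j ω)) T (η ω) i) =
        fun ω => unstep μ (g (i + 1) (Z i ω)) (Z (i + 1) ω, X (i + 1) ω)
          (fill μ g (fun j => (Z j ω, X j ω)) T (η ω) (i + 1)) := by
      funext ω
      rw [fill, if_pos hiT]
    rw [hfun]
    rw [hist_succ] at h2
    have hF : Measurable (Function.uncurry fun ω => g (i + 1) (Z i ω)) :=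
      hgi.measurable.comp (((h.measurable_chain i).comp measurable_fst).prodMk measurable_snd)
    exact ⟨measurable_unstep hF h1 (h.measurable (i + 1)),
      indep_unstep hQ hgi (hist_le h.measurable i)
        (measurable_fst_hist (W := fun j ω => (Z j ω, X j ω)) i) (h.measurable (i + 1)) h1
        (h.condLaw i) h2 h3⟩

end Explore

/-! ### Points under the graph of a soft local time -/

section Decomposition

variable {Ω S : Type*} {g : ℕ → S → S → ℝ≥0} {Z : ℕ → Ω → S} {X : ℕ → Ω → ℝ} {ω : Ω}

lemma softLocalTime_succ (n : ℕ) (z : S) :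
    softLocalTime X g Z (n + 1) ω z =
      softLocalTime X g Z n ω z + X (n + 1) ω * g (n + 1) (Z n ω) z := by
  rw [softLocalTime, Finset.sum_Icc_succ_top (by omega), softLocalTime, Nat.add_sub_cancel]

lemma softLocalTime_mono (hX : ∀ k ≥ 1, 0 ≤ X k ω) (z : S) :
    Monotone fun n => softLocalTime X g Z n ω z := by
  refine monotone_nat_of_le_succ fun n => ?_
  rw [softLocalTime_succ]
  have := mul_nonneg (hX (n + 1) (by omega)) (g (n + 1) (Z n ω) z).2
  exact le_add_of_nonneg_right this

lemma softLocalTime_congr {Y : ℕ → Ω → ℝ} (h : ∀ k ≥ 1, X k ω = Y k ω) (n : ℕ) (z : S) :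
    softLocalTime X g Z n ω z = softLocalTime Y g Z n ω z :=
  Finset.sum_congr rfl fun k hk => by rw [h k (Finset.mem_Icc.1 hk).1]

variable [MeasurableSpace S] {R : ℕ → Measure (S × ℝ)}

lemma measurable_softLocalTime (hg : ∀ i ≥ 1, ∀ x, Measurable (g i x)) (n : ℕ) :
    Measurable (softLocalTime X g Z n ω) := by
  unfold softLocalTime
  exact Finset.measurable_sum _ fun k hk =>
    ((hg k (Finset.mem_Icc.1 hk).1 _).coe_nnreal_real).const_mul _

/-- Translation upwards by the soft local time field. -/
noncomputable def raiseField (X : ℕ → Ω → ℝ) (g : ℕ → S → S → ℝ≥0) (Z : ℕ → Ω → S) (n : ℕ) (ω : Ω)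
    (p : S × ℝ) : S × ℝ :=
  (p.1, p.2 + softLocalTime X g Z n ω p.1)

lemma measurable_raiseField (hg : ∀ i ≥ 1, ∀ x, Measurable (g i x)) (n : ℕ) :
    Measurable (raiseField X g Z n ω) :=
  measurable_fst.prodMk (measurable_snd.add ((measurable_softLocalTime hg n).comp measurable_fst))

/-- `R n` is obtained from `R (n + 1)` by inserting the point found at step `n + 1`. -/
def IsInsertion (g : ℕ → S → S → ℝ≥0) (Z : ℕ → Ω → S) (X : ℕ → Ω → ℝ) (ω : Ω)
    (R : ℕ → Measure (S × ℝ)) (n : ℕ) : Prop :=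
  R n = (R (n + 1)).map (raise (g (n + 1) (Z n ω)) (X (n + 1) ω)) +
    Measure.dirac (Z (n + 1) ω, X (n + 1) ω * g (n + 1) (Z n ω) (Z (n + 1) ω))

/-- Successive translations add up to the soft local time. The point found at step `k` is lifted by
the earlier increments onto the graph of the `k`-th field, and `R n` is lifted by the whole `n`-th
field. -/
lemma eq_map_raiseField_add_sum (hg : ∀ i ≥ 1, ∀ x, Measurable (g i x)) {N : ℕ}
    (hR : ∀ n < N, IsInsertion g Z X ω R n) {n : ℕ} (hn : n ≤ N) :
    R 0 = (R n).map (raiseField X g Z n ω) + ∑ k ∈ Finset.Icc 1 n,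
      Measure.dirac (Z k ω, softLocalTime X g Z k ω (Z k ω)) := by
  induction n with
  | zero =>
    have : raiseField X g Z 0 ω = id := by
      funext p; simp [raiseField, softLocalTime]
    simp [this]
  | succ n ih =>
    have hm := measurable_raiseField (X := X) (Z := Z) (ω := ω) hg n
    have hr : Measurable (raise (g (n + 1) (Z n ω)) (X (n + 1) ω)) :=
      measurable_raise (hg (n + 1) (by omega) _) _
    have hcomp : raiseField X g Z n ω ∘ raise (g (n + 1) (Z n ω)) (X (n + 1) ω) =
        raiseField X g Z (n + 1) ω := by
      funext p
      simp only [Function.comp, raiseField, raise, softLocalTime_succ]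
      rw [add_assoc, add_comm (X (n + 1) ω * _)]
    rw [ih (by omega), hR n (by omega), Measure.map_add _ _ hm, Measure.map_map hm hr, hcomp,
      Measure.map_dirac' hm, Finset.sum_Icc_succ_top (by omega), add_assoc]
    have hpt : raiseField X g Z n ω (Z (n + 1) ω, X (n + 1) ω * g (n + 1) (Z n ω) (Z (n + 1) ω)) =
        (Z (n + 1) ω, softLocalTime X g Z (n + 1) ω (Z (n + 1) ω)) := by
      simp only [raiseField, softLocalTime_succ]
      rw [add_comm (X (n + 1) ω * _)]
    rw [hpt, add_comm (Measure.dirac _)]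

/-- Since `R n` charges only positive heights, its lifted copy charges no singleton on or below the
graph. An atom there must come from the finite sum of found points. -/
lemma mem_range_of_singleton_ne_zero [MeasurableSingletonClass S]
    (hg : ∀ i ≥ 1, ∀ x, Measurable (g i x)) {N : ℕ}
    (hR : ∀ n < N, IsInsertion g Z X ω R n) {n : ℕ} (hn : n ≤ N)
    (hpos : R n {p | p.2 ≤ 0} = 0) {z : S} {v : ℝ} (hzv : R 0 {(z, v)} ≠ 0)
    (hv : v ≤ softLocalTime X g Z n ω z) : z ∈ range Z n ω := by
  rw [eq_map_raiseField_add_sum hg hR hn, Measure.add_apply,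
    Measure.map_apply (measurable_raiseField hg n) (measurableSet_singleton _)] at hzv
  have h0 : R n (raiseField X g Z n ω ⁻¹' {(z, v)}) = 0 := by
    refine measure_mono_null ?_ hpos
    rintro ⟨a, b⟩ hab
    simp only [raiseField, Set.mem_preimage, Set.mem_singleton_iff, Prod.mk.injEq] at hab
    obtain ⟨rfl, rfl⟩ := hab
    change b ≤ 0
    linarith
  rw [h0, zero_add, Measure.finsetSum_apply] at hzv
  obtain ⟨k, hk, hne⟩ := Finset.exists_ne_zero_of_sum_ne_zero hzv
  refine ⟨k, Finset.mem_Icc.1 hk, ?_⟩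
  by_contra hZ
  refine hne ?_
  rw [Measure.dirac_apply' _ (measurableSet_singleton _), Set.indicator_of_notMem]
  exact fun h => hZ (congrArg Prod.fst h)

lemma singleton_ne_zero [MeasurableSingletonClass S]
    (hg : ∀ i ≥ 1, ∀ x, Measurable (g i x)) {N : ℕ}
    (hR : ∀ n < N, IsInsertion g Z X ω R n) {k : ℕ} (hk : k ∈ Set.Icc 1 N) :
    R 0 {(Z k ω, softLocalTime X g Z k ω (Z k ω))} ≠ 0 := by
  rw [eq_map_raiseField_add_sum hg hR hk.2, Measure.add_apply, Measure.finsetSum_apply]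
  refine ne_of_gt (lt_of_lt_of_le one_pos (le_add_left ?_))
  refine le_trans ?_ (Finset.single_le_sum (fun _ _ => zero_le) (Finset.mem_Icc.2 ⟨hk.1, le_rfl⟩))
  rw [Measure.dirac_apply' _ (measurableSet_singleton _), Set.indicator_of_mem
    (Set.mem_singleton _), Pi.one_apply]

/-- If two sequences explore the same configuration, an inequality between the soft local times
implies an inclusion between the ranges. -/
theorem range_subset_of_softLocalTime_le [MeasurableSingletonClass S]
    {g' : ℕ → S → S → ℝ≥0} {Z' : ℕ → Ω → S} {X' : ℕ → Ω → ℝ} {R' : ℕ → Measure (S × ℝ)}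
    (hg : ∀ i ≥ 1, ∀ x, Measurable (g i x)) (hg' : ∀ i ≥ 1, ∀ x, Measurable (g' i x)) {N : ℕ}
    (hR : ∀ n < N, IsInsertion g Z X ω R n) (hR' : ∀ n < N, IsInsertion g' Z' X' ω R' n)
    (h0 : R 0 = R' 0) (hX' : ∀ k ≥ 1, 0 ≤ X' k ω) {p m : ℕ} (hp : p ≤ N) (hm : m ≤ N)
    (hpos : R m {p | p.2 ≤ 0} = 0)
    (hle : ∀ z, softLocalTime X' g' Z' p ω z ≤ softLocalTime X g Z m ω z) :
    range Z' p ω ⊆ range Z m ω := by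
  rintro _ ⟨k, hk, rfl⟩
  refine mem_range_of_singleton_ne_zero hg hR hm hpos
    (h0 ▸ singleton_ne_zero hg' hR' ⟨hk.1, hk.2.trans hp⟩) ?_
  -- The point found at step `k ≤ p` lies on the `k`-th graph of `Z'`, hence, the marks being
  -- nonnegative, under the `p`-th one and so under that of `Z`.
  exact (softLocalTime_mono hX' _ hk.2).trans (hle _)

end Decomposition

/-! ### Assembling the coupling -/

section Integral

variable {Ω S : Type*} [MeasurableSpace S] {μ : Measure S} {g : ℕ → S → S → ℝ≥0} {Z : ℕ → Ω → S}
  {X : ℕ → Ω → ℝ} {ω : Ω}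

lemma integrable_density {f : S → S → ℝ≥0} (hf : IsTransitionDensity μ f) (x : S) :
    Integrable (fun z => (f x z : ℝ)) μ ∧ ∫ z, (f x z : ℝ) ∂μ = 1 := by
  have hm : Measurable fun z => (f x z : ℝ) := (hf.measurable_left x).coe_nnreal_real
  have h0 : ∀ᵐ z ∂μ, 0 ≤ (f x z : ℝ) := Filter.Eventually.of_forall fun z => (f x z).2
  have hint : ∫⁻ z, ENNReal.ofReal (f x z : ℝ) ∂μ = 1 := by
    simpa using hf.lintegral_eq_one x
  constructor
  · refine ⟨hm.aestronglyMeasurable, ?_⟩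
    rw [hasFiniteIntegral_iff_ofReal h0, hint]
    exact ENNReal.one_lt_top
  · rw [integral_eq_lintegral_of_nonneg_ae h0 hm.aestronglyMeasurable, hint, ENNReal.toReal_one]

/-- Each density has total mass one, so the integral sees only the marks. A pointwise inequality of
fields thereby becomes an inequality between sums of marks, which is what fails on the exceptional
set. -/
lemma integral_softLocalTime (hg : ∀ i ≥ 1, IsTransitionDensity μ (g i)) (n : ℕ) :
    Integrable (softLocalTime X g Z n ω) μ ∧
      ∫ z, softLocalTime X g Z n ω z ∂μ = ∑ k ∈ Finset.Icc 1 n, X k ω := by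
  have h : ∀ k ∈ Finset.Icc 1 n, Integrable (fun z => X k ω * (g k (Z (k - 1) ω) z : ℝ)) μ :=
    fun k hk => (integrable_density (hg k (Finset.mem_Icc.1 hk).1) _).1.const_mul _
  refine ⟨integrable_finsetSum _ h, ?_⟩
  simp only [softLocalTime]
  rw [integral_finsetSum _ h]
  refine Finset.sum_congr rfl fun k hk => ?_
  rw [integral_const_mul, (integrable_density (hg k (Finset.mem_Icc.1 hk).1) _).2, mul_one]

end Integral

lemma intensity_nonpos {S : Type*} [MeasurableSpace S] (μ : Measure S) :
    intensity μ {p | p.2 ≤ 0} = 0 := by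
  have : {p : S × ℝ | p.2 ≤ 0} = Set.univ ×ˢ Set.Iic 0 := by ext; simp
  rw [this, intensity, Measure.prod_prod, Measure.restrict_apply measurableSet_Iic, Set.inter_comm,
    Set.Ici_inter_Iic, Set.Icc_self, Real.volume_singleton, mul_zero]

lemma IsPoissonLaw.ae_of_map {Ω S : Type*} {mΩ : MeasurableSpace Ω} [MeasurableSpace S]
    {μ : Measure S} [SigmaFinite μ] {P : Measure Ω} {Q : Measure (Measure (S × ℝ))}
    {R : Ω → Measure (S × ℝ)} (hQ : IsPoissonLaw (intensity μ) Q) (hR : Measurable R)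
    (hRQ : P.map R = Q) :
    ∀ᵐ ω ∂P, configKernel (intensity μ) (R ω) = R ω ∧ R ω {p | p.2 ≤ 0} = 0 := by
  refine ae_of_ae_map (p := fun m : Measure (S × ℝ) =>
    configKernel (intensity μ) m = m ∧ m {p | p.2 ≤ 0} = 0) hR.aemeasurable ?_
  rw [hRQ]
  filter_upwards [hQ.ae_isConfig, hQ.ae_eval_eq_zero
    (measurableSet_le measurable_snd measurable_const) (intensity_nonpos μ)] with m h1 h2
  exact ⟨configKernel_apply h1, h2⟩

lemma ae_nonneg_of_map_eq_expMeasure {Ω : Type*} {mΩ : MeasurableSpace Ω} {P : Measure Ω}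
    {X : Ω → ℝ} (hX : Measurable X) (h : P.map X = expMeasure 1) : ∀ᵐ ω ∂P, 0 ≤ X ω := by
  refine ae_of_ae_map (p := fun t : ℝ => 0 ≤ t) hX.aemeasurable ?_
  rw [h, ae_iff]
  have hm : MeasurableSet {t : ℝ | ¬ 0 ≤ t} := measurableSet_Ici.compl
  rw [← lintegral_indicator_one hm, lintegral_expMeasure_one (measurable_one.indicator hm)]
  refine (setLIntegral_congr_fun measurableSet_Ioi fun t ht => ?_).trans lintegral_zero
  rw [Set.indicator_of_notMem (by simpa using (Set.mem_Ioi.1 ht).le), mul_zero]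

/-- The backward insertion needs `η₀` independent of `Z` and `ξ` jointly. This follows by factoring
first over the chain, then over the pair `(ξ, η₀)`. -/
lemma ExtendedSetup.indep_poisson {Ω S : Type*} [MeasurableSpace Ω] [MeasurableSpace S]
    {P : Measure Ω} [IsProbabilityMeasure P] {μ : Measure S} {g : ℕ → S → S → ℝ≥0} {Z : ℕ → Ω → S}
    {ξ : ℕ → Ω → ℝ} {η₀ : Ω → Measure (S × ℝ)} (h : ExtendedSetup P μ g Z ξ η₀) :
    Indep (MeasurableSpace.comap (fun ω (i : ℕ) => Z i ω) inferInstance ⊔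
        MeasurableSpace.comap (fun ω (k : ℕ) => ξ (k + 1) ω) inferInstance)
      (MeasurableSpace.comap η₀ inferInstance) P := by
  have hZ : Measurable fun ω (i : ℕ) => Z i ω := measurable_pi_lambda _ h.markov.measurable
  have hξ : Measurable fun ω (k : ℕ) => ξ (k + 1) ω :=
    measurable_pi_lambda _ fun k => h.exponential.measurable (k + 1) (by omega)
  refine indep_sup_left_of_inter (measurable_iff_comap_le.1 hZ) (measurable_iff_comap_le.1 hξ)
    (measurable_iff_comap_le.1 h.poisson.measurable) ?_
  rintro _ _ _ ⟨a, ha, rfl⟩ ⟨b, hb, rfl⟩ ⟨d, hd, rfl⟩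
  have h1 := h.indep_chain.measure_inter_preimage_eq_mul _ _ ha (hb.prod hd)
  have h2 := h.indep_chain.measure_inter_preimage_eq_mul _ _ ha (hb.prod MeasurableSet.univ)
  have h3 := h.indep_exponential_poisson.measure_inter_preimage_eq_mul _ _ hb hd
  rw [Set.mk_preimage_prod] at h1 h2
  rw [Set.preimage_univ, Set.inter_univ] at h2
  rw [Set.inter_assoc, h1, h2, h3, mul_assoc]

theorem exists_coupling {S : Type*} [MeasurableSpace S] [StandardBorelSpace S] (μ : Measure S)
    [SigmaFinite μ] (g : ℕ → S → S → ℝ≥0) (hg : ∀ i ≥ 1, IsTransitionDensity μ (g i))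
    {Ω : Type*} [MeasurableSpace Ω] (P : Measure Ω) [IsProbabilityMeasure P]
    (Z : ℕ → Ω → S) (ξ : ℕ → Ω → ℝ) (η₀ : Ω → Measure (S × ℝ))
    (hsetup : ExtendedSetup P μ g Z ξ η₀) (T : ℕ) (z' : S)
    (g' : ℕ → S → S → ℝ≥0) (hg' : ∀ i ≥ 1, IsTransitionDensity μ (g' i)) :
    ∃ (Z' : ℕ → Ω → S) (ξ' : ℕ → Ω → ℝ),
      ((∀ ω, Z' 0 ω = z') ∧ IsMarkovChain P μ g' Z') ∧
      (IsIIDExp P ξ' ∧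
        IndepFun (fun ω (k : ℕ) => ξ' (k + 1) ω) (fun ω (i : ℕ) => Z' i ω) P) ∧
      ∀ p ∈ Set.Icc 1 T, ∀ m ∈ Set.Icc 1 T, ∀ n ∈ Set.Icc 1 T,
        {ω | ∀ z, softLocalTime ξ' g' Z' p ω z ≤ softLocalTime ξ g Z m ω z ∧
            softLocalTime ξ g Z m ω z ≤ softLocalTime ξ' g' Z' n ω z} ⊆
          {ω | range Z' p ω ⊆ range Z m ω ∧ range Z m ω ⊆ range Z' n ω} := by
  classical
  have : Nonempty S := ⟨z'⟩
  have hQ := hsetup.poisson.isPoissonLaw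
  have hη₀ := hsetup.poisson.measurable
  -- The value `ξ 0` is unconstrained and may not be measurable. It is replaced by zero, which no
  -- soft local time sees.
  let X : ℕ → Ω → ℝ := fun k => if k = 0 then fun _ => 0 else ξ k
  have hX0 : ∀ ω, X 0 ω = 0 := fun _ => rfl
  have hXk : ∀ k ≥ 1, X k = ξ k := fun k hk => if_neg (by omega)
  have hXs : (fun k => X (k + 1)) = fun k => ξ (k + 1) := by
    funext k; exact hXk (k + 1) (by omega)
  have hXm : ∀ n, Measurable (X n) := fun n => by
    rcases Nat.eq_zero_or_pos n with rfl | hn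
    · exact measurable_const
    · rw [hXk n hn]; exact hsetup.exponential.measurable n hn
  have hXexp : IsIIDExp P X := by
    refine ⟨fun k _ => hXm k, fun k hk => ?_, ?_⟩
    · rw [hXk k hk]; exact hsetup.exponential.law k hk
    · rw [hXs]; exact hsetup.exponential.indep
  have hXseq : (fun ω (k : ℕ) => X (k + 1) ω) = fun ω (k : ℕ) => ξ (k + 1) ω := by
    funext ω k; exact congrFun (congrFun hXs k) ω
  have hZX : IsMarkedChain P μ g Z X := by
    refine isMarkedChain_of_indepFun hg hsetup.markov hXm hX0 hXexp ?_
    rw [hXseq]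
    exact hsetup.indep_chain.comp measurable_id measurable_fst
  have hind : Indep (hist (fun j ω => (Z j ω, X j ω)) T)
      (MeasurableSpace.comap η₀ inferInstance) P := by
    refine indep_of_indep_of_le_left hsetup.indep_poisson (iSup₂_le fun j _ => ?_)
    rw [← measurable_iff_comap_le]
    have h1 : Measurable[MeasurableSpace.comap (fun ω (i : ℕ) => Z i ω) inferInstance] (Z j) :=
      (measurable_pi_apply j).comp (comap_measurable fun ω (i : ℕ) => Z i ω)
    have h2 : Measurable[MeasurableSpace.comap (fun ω (k : ℕ) => ξ (k + 1) ω) inferInstance]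
        (X j) := by
      rcases j with _ | j
      · exact measurable_const
      · rw [hXk (j + 1) (by omega)]
        exact (measurable_pi_apply j).comp (comap_measurable fun ω (k : ℕ) => ξ (k + 1) ω)
    exact (h1.mono le_sup_left le_rfl).prodMk (h2.mono le_sup_right le_rfl)
  -- `R T` is `η₀`, and `R 0` is the Poisson process in which `Z` and `ξ` are encoded up to time
  -- `T`.
  let R : ℕ → Ω → Measure (S × ℝ) := fun i ω =>
    fill μ g (fun j => (Z j ω, X j ω)) T (η₀ ω) i
  have hR : ∀ i ≤ T, Measurable (R i) ∧ P.map (R i) = P.map η₀ := fun i hi =>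
    have h := fill_spec hQ hg hZX hη₀ rfl hind hi
    ⟨h.1, h.2.2⟩
  obtain ⟨hη, hηQ⟩ := hR 0 (Nat.zero_le T)
  -- The second chain explores the same configuration `R 0`; this is the whole coupling.
  let E : ℕ → Ω → (S × ℝ) × Measure (S × ℝ) := fun n ω => explore μ g' z' (R 0 ω) n
  let Z' : ℕ → Ω → S := fun n ω => (E n ω).1.1
  let X' : ℕ → Ω → ℝ := fun n ω => (E n ω).1.2
  let R' : ℕ → Ω → Measure (S × ℝ) := fun n ω => (E n ω).2
  have hE : ∀ n, Measurable (E n) := measurable_explore hg' hη z'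
  have hZX' : IsMarkedChain P μ g' Z' X' := isMarkedChain_explore hQ hg' hη hηQ z'
  have hmg : ∀ i ≥ 1, ∀ x, Measurable (g i x) := fun i hi x => (hg i hi).measurable_left x
  have hmg' : ∀ i ≥ 1, ∀ x, Measurable (g' i x) := fun i hi x => (hg' i hi).measurable_left x
  have hgood : ∀ᵐ ω ∂P, ((∀ n < T, IsInsertion g Z X ω (fun i => R i ω) n) ∧
      (∀ n ≤ T, R n ω {p | p.2 ≤ 0} = 0) ∧ ∀ k ≥ 1, 0 ≤ X k ω) ∧
      (∀ n, IsInsertion g' Z' X' ω (fun i => R' i ω) n) ∧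
      (∀ n, R' n ω {p | p.2 ≤ 0} = 0) ∧ ∀ k ≥ 1, 0 ≤ X' k ω := by
    have h1 : ∀ᵐ ω ∂P, ∀ n, n ≤ T →
        configKernel (intensity μ) (R n ω) = R n ω ∧ R n ω {p | p.2 ≤ 0} = 0 :=
      ae_all_iff.2 fun n => Filter.eventually_imp_distrib_left.2 fun hn =>
        hQ.ae_of_map (hR n hn).1 (hR n hn).2
    have h2 : ∀ᵐ ω ∂P, ∀ k, 0 ≤ X (k + 1) ω := ae_all_iff.2 fun k =>
      ae_nonneg_of_map_eq_expMeasure (hXm _) (hXexp.law _ (by omega))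
    have h3 : ∀ᵐ ω ∂P, ∀ n,
        configKernel (intensity μ) (R' n ω) = R' n ω ∧ R' n ω {p | p.2 ≤ 0} = 0 :=
      ae_all_iff.2 fun n => hQ.ae_of_map (hE n).snd (indep_explore hQ hg' hη hηQ z' n).2
    have h4 := ae_all_iff.2 (ae_explore hQ hg' hη hηQ z')
    filter_upwards [h1, h2, h3, h4] with ω h1 h2 h3 h4
    refine ⟨⟨fun n hn => ?_, fun n hn => (h1 n hn).2, fun k hk => ?_⟩, fun n => ?_,
      fun n => (h3 n).2, fun k hk => ?_⟩
    · have hstep : R n ω = unstep μ (g (n + 1) (Z n ω)) (Z (n + 1) ω, X (n + 1) ω)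
          (R (n + 1) ω) := by
        simp only [R]
        rw [fill, if_pos hn]
      rw [unstep, (h1 (n + 1) hn).1] at hstep
      exact hstep
    · obtain ⟨k, rfl⟩ := Nat.exists_eq_add_of_le' hk
      exact h2 k
    · have hstep := (h4 n).1.symm
      rw [unstep, (h3 (n + 1)).1] at hstep
      exact hstep
    · obtain ⟨k, rfl⟩ := Nat.exists_eq_add_of_le' hk
      exact (h4 k).2.le
  -- A measurable null set is needed for the modified marks to be measurable.
  obtain ⟨N, hNsub, hNm, hN0⟩ := exists_measurable_superset_of_null (ae_iff.1 hgood)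
  -- On `N`, with `s` the sum of the `|ξ j|` up to `T`, the sum of `n ≥ 1` modified marks is at most
  -- `-1 - s`, while the sum of the first `m ≤ T` marks `ξ` is at least `-s`. This rules out the
  -- upper inequality between the integrated fields.
  let ξ' : ℕ → Ω → ℝ := fun k => N.piecewise (fun ω => -1 - ∑ j ∈ Finset.Icc 1 T, |ξ j ω|) (X' k)
  have hξ'ae : ∀ k, X' k =ᵐ[P] ξ' k := fun k => by
    filter_upwards [measure_eq_zero_iff_ae_notMem.1 hN0] with ω hω
    exact (Set.piecewise_eq_of_notMem _ _ _ hω).symm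
  have hξ'm : ∀ k, Measurable (ξ' k) := fun k => by
    refine Measurable.piecewise hNm (measurable_const.sub ?_) (hE k).fst.snd
    exact Finset.measurable_sum _ fun j hj =>
      (hsetup.exponential.measurable j (Finset.mem_Icc.1 hj).1).abs
  have hiid := hZX'.isIIDExp hg'
  refine ⟨Z', ξ', ⟨fun ω => rfl, hZX'.isMarkovChain hg'⟩,
    ⟨⟨fun k _ => hξ'm k, fun k hk => ?_, ?_⟩, ?_⟩, ?_⟩
  · rw [← Measure.map_congr (hξ'ae k)]
    exact hiid.law k hk
  · exact hiid.indep.congr fun k => hξ'ae (k + 1)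
  · refine (indepFun_of_indep_hist hZX'.measurable_mark hZX'.measurable_chain
      (hZX'.indep_hist hg' (c := 0) fun _ => rfl)).congr ?_ Filter.EventuallyEq.rfl
    filter_upwards [ae_all_iff.2 fun k => hξ'ae (k + 1)] with ω hω
    exact funext hω
  · intro p hp m hm n hn ω hω
    have hωz : ∀ z, softLocalTime ξ' g' Z' p ω z ≤ softLocalTime ξ g Z m ω z ∧
      softLocalTime ξ g Z m ω z ≤ softLocalTime ξ' g' Z' n ω z := hω
    by_cases hωN : ω ∈ N
    · exfalso
      obtain ⟨hi1, hi2⟩ := integral_softLocalTime (X := ξ) (Z := Z) (ω := ω) hg m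
      obtain ⟨hi3, hi4⟩ := integral_softLocalTime (X := ξ') (Z := Z') (ω := ω) hg' n
      have hle := integral_mono hi1 hi3 fun z => (hωz z).2
      rw [hi2, hi4] at hle
      have hξ'ω : ∀ k, ξ' k ω = -1 - ∑ j ∈ Finset.Icc 1 T, |ξ j ω| := fun k =>
        Set.piecewise_eq_of_mem _ _ _ hωN
      simp only [hξ'ω, Finset.sum_const, Nat.card_Icc, Nat.add_sub_cancel, nsmul_eq_mul] at hle
      have hs0 : 0 ≤ ∑ j ∈ Finset.Icc 1 T, |ξ j ω| := Finset.sum_nonneg fun _ _ => abs_nonneg _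
      have hs1 : -∑ j ∈ Finset.Icc 1 T, |ξ j ω| ≤ ∑ k ∈ Finset.Icc 1 m, ξ k ω := by
        have h1 : -∑ k ∈ Finset.Icc 1 m, |ξ k ω| ≤ ∑ k ∈ Finset.Icc 1 m, ξ k ω := by
          rw [← Finset.sum_neg_distrib]
          exact Finset.sum_le_sum fun k _ => neg_abs_le _
        have h2 : ∑ k ∈ Finset.Icc 1 m, |ξ k ω| ≤ ∑ j ∈ Finset.Icc 1 T, |ξ j ω| :=
          Finset.sum_le_sum_of_subset_of_nonneg (Finset.Icc_subset_Icc_right hm.2)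
            fun _ _ _ => abs_nonneg _
        linarith
      have hn1 : (1 : ℝ) ≤ n := by exact_mod_cast hn.1
      nlinarith
    · have hg0 := not_not.1 fun h => hωN (hNsub h)
      obtain ⟨⟨a1, a2, a3⟩, b1, b2, b3⟩ := hg0
      have hξX : ∀ k z, softLocalTime ξ g Z k ω z = softLocalTime X g Z k ω z := fun k z =>
        softLocalTime_congr (fun j hj => by rw [hXk j hj]) k z
      have hξX' : ∀ k z, softLocalTime ξ' g' Z' k ω z = softLocalTime X' g' Z' k ω z := fun k z =>
        softLocalTime_congr (fun j _ => Set.piecewise_eq_of_notMem _ _ _ hωN) k z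
      simp only [hξX, hξX'] at hωz
      exact ⟨range_subset_of_softLocalTime_le hmg hmg' a1 (fun k _ => b1 k) rfl b3 hp.2 hm.2
          (a2 m hm.2) fun z => (hωz z).1,
        range_subset_of_softLocalTime_le hmg' hmg (fun k _ => b1 k) a1 rfl a3 hm.2 hn.2
          (b2 n) fun z => (hωz z).2⟩

end InverseSLT

theorem proposition4p4 {S : Type*} [TopologicalSpace S] [PolishSpace S] [LocallyCompactSpace S]
    [MeasurableSpace S] [BorelSpace S] (μ : Measure S) [IsFiniteMeasureOnCompacts μ]
    (g : ℕ → S → S → ℝ≥0) (hg : ∀ i ≥ 1, InverseSLT.IsTransitionDensity μ (g i))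
    {Ω : Type*} [MeasurableSpace Ω] (P : Measure Ω) [IsProbabilityMeasure P]
    (Z : ℕ → Ω → S) (ξ : ℕ → Ω → ℝ) (η₀ : Ω → Measure (S × ℝ))
    (hsetup : InverseSLT.ExtendedSetup P μ g Z ξ η₀)
    (T : ℕ) (hT : 1 ≤ T) (z' : S)
    (g' : ℕ → S → S → ℝ≥0) (hg' : ∀ i ≥ 1, InverseSLT.IsTransitionDensity μ (g' i)) :
    ∃ (Z' : ℕ → Ω → S) (ξ' : ℕ → Ω → ℝ),
      ((∀ ω, Z' 0 ω = z') ∧ InverseSLT.IsMarkovChain P μ g' Z') ∧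
      (InverseSLT.IsIIDExp P ξ' ∧
        IndepFun (fun ω (k : ℕ) => ξ' (k + 1) ω) (fun ω (i : ℕ) => Z' i ω) P) ∧
      ∀ p ∈ Set.Icc 1 T, ∀ m ∈ Set.Icc 1 T, ∀ n ∈ Set.Icc 1 T,
        {ω | ∀ z, InverseSLT.softLocalTime ξ' g' Z' p ω z ≤ InverseSLT.softLocalTime ξ g Z m ω z ∧
            InverseSLT.softLocalTime ξ g Z m ω z ≤ InverseSLT.softLocalTime ξ' g' Z' n ω z} ⊆
          {ω | InverseSLT.range Z' p ω ⊆ InverseSLT.range Z m ω ∧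
            InverseSLT.range Z m ω ⊆ InverseSLT.range Z' n ω} := by
  -- A Polish space with its Borel σ-algebra is standard Borel, and a measure finite on compacts of
  -- a locally compact second countable space is σ-finite.
  exact InverseSLT.exists_coupling μ g hg P Z ξ η₀ hsetup T z' g' hg'
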